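/- Let $\Bbbk=\mathbb R$ or $\mathbb C$; all schemes are over $\Bbbk$, and $\Bbbk[Z]$ is the coordinate algebra of an affine scheme $Z$. An affine algebraic Lie groupoid $\mathcal G\rightrightarrows X$ is a groupoid object in affine varieties with $\mathcal G$, $X$ smooth and source $\mathsf s$ and target $\mathsf t$ smooth. An affine $\mathcal G$-scheme is an affine scheme $M$ with a moment map $\mu:M\to X$ and an action morphism $\mathcal A:\mathcal G\times_{\mathsf s,X,\mu}M\to M$ (equivalently a coaction $\mathcal A^*:\Bbbk[M]\to\Bbbk[\mathcal G]\otimes_{\Bbbk[X]}\Bbbk[M]$) satisfying the axioms of a left groupoid action. Let $\mathcal G\rightrightarrows X$ and $\mathcal I\rightrightarrows Y$ be affine algebraic Lie groupoids, $\mathcal H\rightrightarrows S$ a closed subgroupoid of $\mathcal I$ over a closed subvariety $S\subseteq Y$, and $M$ an affine scheme with commuting actions of $\mathcal G$ (moment map $\mu$, coaction $\mathcal A^*$) and of $\mathcal I$ (moment map $\nu$). Here commuting means that $\mu$ is $\mathcal I$-invariant, $\nu$ is $\mathcal G$-invariant and $g(hx)=h(gx)$. Let $j:\nu^{-1}(S)\to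 M$ be the inclusion of the scheme-theoretic preimage. It carries the restricted action of $\mathcal H$ with coaction $\mathcal B^*:\Bbbk[\nu^{-1}(S)]\to\Bbbk[\mathcal H]\otimes_{\Bbbk[S]}\Bbbk[\nu^{-1}(S)]$. Put $\Bbbk[\nu^{-1}(S)]^{\mathcal H}=\{f:\mathcal B^*f=1\otimes f\}$ and $M/\!\!/_{S,\mathcal H}\mathcal I=\operatorname{Spec}\Bbbk[\nu^{-1}(S)]^{\mathcal H}$, and let $\overline\mu:M/\!\!/_{S,\mathcal H}\mathcal I\to X$ be induced by $\mu$. Then: (i) $\mathcal A^*$ descends to an algebra morphism $\overline{\mathcal A^*}:\Bbbk[\nu^{-1}(S)]\to\Bbbk[\mathcal G]\otimes_{\Bbbk[X]}\Bbbk[\nu^{-1}(S)]$, i.e. $\overline{\mathcal A^*}\circ j^*=(\mathrm{id}\otimes j^*)\circ\mathcal A^*$. (ii) The natural map $\Bbbk[\mathcal G]\otimes_{\Bbbk[X]}\Bbbk[\nu^{-1}(S)]^{\mathcal H}\to\Bbbk[\mathcal G]\otimes_{\Bbbk[X]}\Bbbk[\nu^{-1}(S)]$ is injective, and its image contains $\overline{\mathcal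 A^*}(\Bbbk[\nu^{-1}(S)]^{\mathcal H})$. (iii) The resulting restriction $\Bbbk[\nu^{-1}(S)]^{\mathcal H}\to\Bbbk[\mathcal G]\otimes_{\Bbbk[X]}\Bbbk[\nu^{-1}(S)]^{\mathcal H}$ is the coaction of an affine $\mathcal G$-scheme structure on $M/\!\!/_{S,\mathcal H}\mathcal I$ with moment map $\overline\mu$. (iv) Suppose in addition that $\mathcal G$ and $\mathcal I$ are affine symplectic groupoids, i.e. carry symplectic forms for which the graph of multiplication is coisotropic in $\mathcal G\times\mathcal G\times\mathcal G^-$ (resp. $\mathcal I\times\mathcal I\times\mathcal I^-$); that $S$ is smooth and coisotropic in $Y$ for the induced Poisson structure; that $\mathcal H\rightrightarrows S$ is a stabilizer subgroupoid, i.e. an algebraic Lie groupoid that is isotropic in $\mathcal I$ and whose Lie algebroid, viewed in $T^*Y$, is $N^*_SY\cap\sigma^{-1}(TS)$, where $\sigma:T^*Y\to TY$ is contraction with the Poisson bivector field; that $M$ is an affine Poisson scheme; and that both actions are Hamiltonian, i.e. the graph of the action is coisotropic in $\mathcal G\times M\times M^-$ (resp. $\mathcal I\times M\times M^-$). Then there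 is a unique Poisson bracket on $\Bbbk[\nu^{-1}(S)]^{\mathcal H}$ with $\{j^*f_1,j^*f_2\}=j^*\{f_1,f_2\}$ for all $f_1,f_2\in\Bbbk[M]$ with $j^*f_1,j^*f_2\in\Bbbk[\nu^{-1}(S)]^{\mathcal H}$, and the $\mathcal G$-scheme structure in (iii) is Hamiltonian for it. -/

import Mathlib

open TensorProduct

noncomputable section

namespace AffineGroupoid

/-! Affine schemes over `k` are represented by their coordinate algebras, and morphisms by the
induced algebra morphisms (comorphisms) in the opposite direction. -/

universe u₁ u₂ u₃ u₄ u₅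

/-! ### Fibre products of affine schemes -/

section FibreProduct

variable {k : Type*} {R : Type u₁} {B : Type u₂} {C : Type u₃} {D : Type u₄} {E : Type u₅}
variable [CommRing k] [CommRing R] [CommRing B] [CommRing C] [CommRing D] [CommRing E]
variable [Algebra k R] [Algebra k B] [Algebra k C] [Algebra k D] [Algebra k E]

/-- The coordinate algebra `B ⊗[R] C` of the fibre product of `Spec B → Spec R` and
`Spec C → Spec R`, where `B` is an `R`-algebra through `σ` and `C` through `τ`. -/
def FibreProd (σ : R →ₐ[k] B) (τ : R →ₐ[k] C) : Type (max u₂ u₃) :=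
  letI := σ.toRingHom.toAlgebra
  letI := τ.toRingHom.toAlgebra
  B ⊗[R] C

namespace FibreProd

variable (σ : R →ₐ[k] B) (τ : R →ₐ[k] C)

instance : CommRing (FibreProd σ τ) :=
  letI := σ.toRingHom.toAlgebra
  letI := τ.toRingHom.toAlgebra
  (inferInstance : CommRing (B ⊗[R] C))

instance : Algebra k (FibreProd σ τ) :=
  letI := σ.toRingHom.toAlgebra
  letI := τ.toRingHom.toAlgebra
  haveI : IsScalarTower k R B := IsScalarTower.of_algebraMap_eq' σ.comp_algebraMap.symm
  haveI : IsScalarTower k R C := IsScalarTower.of_algebraMap_eq' τ.comp_algebraMap.symm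
  (inferInstance : Algebra k (B ⊗[R] C))

/-- The comorphism `b ↦ b ⊗ 1` of the first projection. -/
def inl : B →ₐ[k] FibreProd σ τ :=
  letI := σ.toRingHom.toAlgebra
  letI := τ.toRingHom.toAlgebra
  haveI : IsScalarTower k R B := IsScalarTower.of_algebraMap_eq' σ.comp_algebraMap.symm
  haveI : IsScalarTower k R C := IsScalarTower.of_algebraMap_eq' τ.comp_algebraMap.symm
  (Algebra.TensorProduct.includeLeft : B →ₐ[k] B ⊗[R] C)

/-- The comorphism `c ↦ 1 ⊗ c` of the second projection. -/
def inr : C →ₐ[k] FibreProd σ τ :=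
  letI := σ.toRingHom.toAlgebra
  letI := τ.toRingHom.toAlgebra
  haveI : IsScalarTower k R B := IsScalarTower.of_algebraMap_eq' σ.comp_algebraMap.symm
  haveI : IsScalarTower k R C := IsScalarTower.of_algebraMap_eq' τ.comp_algebraMap.symm
  ((Algebra.TensorProduct.includeRight : C →ₐ[R] B ⊗[R] C).restrictScalars k)

theorem inl_comp : (inl σ τ).comp σ = (inr σ τ).comp τ := by
  let _ := σ.toRingHom.toAlgebra
  let _ := τ.toRingHom.toAlgebra
  have : IsScalarTower k R B := IsScalarTower.of_algebraMap_eq' σ.comp_algebraMap.symm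
  have : IsScalarTower k R C := IsScalarTower.of_algebraMap_eq' τ.comp_algebraMap.symm
  ext r
  exact (Algebra.TensorProduct.algebraMap_apply r).symm.trans
    (Algebra.TensorProduct.algebraMap_apply' r)

variable {σ τ}

/-- The universal property of the fibre product: `b ⊗ c ↦ f b * g c`. -/
def lift (f : B →ₐ[k] D) (g : C →ₐ[k] D) (w : f.comp σ = g.comp τ) : FibreProd σ τ →ₐ[k] D :=
  letI := σ.toRingHom.toAlgebra
  letI := τ.toRingHom.toAlgebra
  letI := (f.comp σ).toRingHom.toAlgebra
  haveI : IsScalarTower k R B := IsScalarTower.of_algebraMap_eq' σ.comp_algebraMap.symm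
  haveI : IsScalarTower k R C := IsScalarTower.of_algebraMap_eq' τ.comp_algebraMap.symm
  haveI : IsScalarTower k R D := IsScalarTower.of_algebraMap_eq' (f.comp σ).comp_algebraMap.symm
  let f' : B →ₐ[R] D := { f.toRingHom with commutes' := fun _ => rfl }
  let g' : C →ₐ[R] D := { g.toRingHom with commutes' := fun r => (DFunLike.congr_fun w r).symm }
  ((Algebra.TensorProduct.productMap f' g' : B ⊗[R] C →ₐ[R] D).restrictScalars k)

@[simp] theorem lift_inl (f : B →ₐ[k] D) (g : C →ₐ[k] D) (w : f.comp σ = g.comp τ) :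
    (lift f g w).comp (inl σ τ) = f := by
  let _ := σ.toRingHom.toAlgebra
  let _ := τ.toRingHom.toAlgebra
  let _ := (f.comp σ).toRingHom.toAlgebra
  ext b
  exact Algebra.TensorProduct.productMap_left_apply _ _ b

@[simp] theorem lift_inr (f : B →ₐ[k] D) (g : C →ₐ[k] D) (w : f.comp σ = g.comp τ) :
    (lift f g w).comp (inr σ τ) = g := by
  let _ := σ.toRingHom.toAlgebra
  let _ := τ.toRingHom.toAlgebra
  let _ := (f.comp σ).toRingHom.toAlgebra
  ext c
  exact Algebra.TensorProduct.productMap_right_apply _ _ c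

/-- The morphism `id ⊗ g : B ⊗[R] C → B ⊗[R] D` induced by an `R`-algebra morphism `g`. -/
def mapRight (σ : R →ₐ[k] B) {τ : R →ₐ[k] C} {τ' : R →ₐ[k] D} (g : C →ₐ[k] D)
    (w : g.comp τ = τ') : FibreProd σ τ →ₐ[k] FibreProd σ τ' :=
  lift (inl σ τ') ((inr σ τ').comp g) (by rw [inl_comp, ← w]; rfl)

/-- The ideal in `(B ⊗ C) ⊗ E` of the graph of a morphism from the fibre product to `Spec E`, i.e.
of the closed subscheme of points `(b, c, f (b, c))`. -/
def graphIdeal (f : E →ₐ[k] FibreProd σ τ) : Ideal ((B ⊗[k] C) ⊗[k] E) :=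
  RingHom.ker
    (Algebra.TensorProduct.productMap (Algebra.TensorProduct.productMap (inl σ τ) (inr σ τ)) f)

end FibreProd

end FibreProduct

/-! ### Affine algebraic Lie groupoids -/

section Groupoid

/-- The structure morphisms of a groupoid `Spec A ⇉ Spec R` with the compatibilities of
multiplication, units and inversion with source and target. A pair `(g, h)` is composable if the
source of `g` is the target of `h`. -/
structure PreGroupoid (k : Type*) [CommRing k] (R : Type u₁) (A : Type u₂) [CommRing R]
    [CommRing A] [Algebra k R] [Algebra k A] where
  /-- source -/
  src : R →ₐ[k] A
  /-- target -/
  tgt : R →ₐ[k] A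
  /-- identity bisection -/
  one : A →ₐ[k] R
  /-- inversion -/
  inv : A →ₐ[k] A
  /-- multiplication -/
  mul : A →ₐ[k] FibreProd src tgt
  one_src : one.comp src = AlgHom.id k R
  one_tgt : one.comp tgt = AlgHom.id k R
  inv_src : inv.comp src = tgt
  inv_tgt : inv.comp tgt = src
  mul_src : mul.comp src = (FibreProd.inr src tgt).comp src
  mul_tgt : mul.comp tgt = (FibreProd.inl src tgt).comp tgt

variable {k : Type*} [CommRing k] {R : Type u₁} {A : Type u₂} [CommRing R]
    [CommRing A] [Algebra k R] [Algebra k A]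

namespace PreGroupoid

variable (𝒢 : PreGroupoid k R A) {D : Type u₃} [CommRing D] [Algebra k D]

/-- The product of two composable `D`-valued points `g`, `h`. -/
def prod (g h : A →ₐ[k] D) (w : g.comp 𝒢.src = h.comp 𝒢.tgt) : A →ₐ[k] D :=
  (FibreProd.lift g h w).comp 𝒢.mul

theorem prod_src (g h : A →ₐ[k] D) (w : g.comp 𝒢.src = h.comp 𝒢.tgt) :
    (𝒢.prod g h w).comp 𝒢.src = h.comp 𝒢.src := by
  rw [prod, AlgHom.comp_assoc, 𝒢.mul_src, ← AlgHom.comp_assoc, FibreProd.lift_inr]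

theorem prod_tgt (g h : A →ₐ[k] D) (w : g.comp 𝒢.src = h.comp 𝒢.tgt) :
    (𝒢.prod g h w).comp 𝒢.tgt = g.comp 𝒢.tgt := by
  rw [prod, AlgHom.comp_assoc, 𝒢.mul_tgt, ← AlgHom.comp_assoc, FibreProd.lift_inl]

/-- The coordinate algebra of the scheme of composable triples `(g, (h, l))`. -/
abbrev Triples : Type u₂ :=
  FibreProd 𝒢.src ((FibreProd.inl 𝒢.src 𝒢.tgt).comp 𝒢.tgt)

/-- The first entry of the universal composable triple. -/
def triple₁ : A →ₐ[k] 𝒢.Triples := FibreProd.inl _ _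

/-- The second entry of the universal composable triple. -/
def triple₂ : A →ₐ[k] 𝒢.Triples := (FibreProd.inr _ _).comp (FibreProd.inl _ _)

/-- The third entry of the universal composable triple. -/
def triple₃ : A →ₐ[k] 𝒢.Triples := (FibreProd.inr _ _).comp (FibreProd.inr _ _)

theorem triple₁₂ : 𝒢.triple₁.comp 𝒢.src = 𝒢.triple₂.comp 𝒢.tgt :=
  FibreProd.inl_comp _ _

theorem triple₂₃ : 𝒢.triple₂.comp 𝒢.src = 𝒢.triple₃.comp 𝒢.tgt := by
  rw [triple₂, triple₃, AlgHom.comp_assoc, FibreProd.inl_comp, AlgHom.comp_assoc]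

end PreGroupoid

/-- An affine algebraic Lie groupoid `Spec A ⇉ Spec R` over `k`: a groupoid object in affine
schemes whose arrows and objects are smooth over `k` and whose source and target are smooth. -/
structure LieGroupoid (k : Type*) [CommRing k] (R : Type u₁) (A : Type u₂) [CommRing R]
    [CommRing A] [Algebra k R] [Algebra k A] extends PreGroupoid k R A where
  mul_one : toPreGroupoid.prod (AlgHom.id k A) (src.comp one)
    (by rw [AlgHom.comp_assoc, one_tgt]; rfl) = AlgHom.id k A
  one_mul : toPreGroupoid.prod (tgt.comp one) (AlgHom.id k A)
    (by rw [AlgHom.comp_assoc, one_src]; rfl) = AlgHom.id k A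
  mul_inv : toPreGroupoid.prod (AlgHom.id k A) inv (by rw [inv_tgt]; rfl) = tgt.comp one
  inv_mul : toPreGroupoid.prod inv (AlgHom.id k A) (by rw [inv_src]; rfl) = src.comp one
  mul_assoc :
    toPreGroupoid.prod
      (toPreGroupoid.prod toPreGroupoid.triple₁ toPreGroupoid.triple₂ toPreGroupoid.triple₁₂)
      toPreGroupoid.triple₃
      ((toPreGroupoid.prod_src _ _ _).trans toPreGroupoid.triple₂₃) =
    toPreGroupoid.prod toPreGroupoid.triple₁
      (toPreGroupoid.prod toPreGroupoid.triple₂ toPreGroupoid.triple₃ toPreGroupoid.triple₂₃)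
      (toPreGroupoid.triple₁₂.trans (toPreGroupoid.prod_tgt _ _ _).symm)
  smooth_objects : Algebra.Smooth k R
  smooth_arrows : Algebra.Smooth k A
  smooth_src : src.toRingHom.Smooth
  smooth_tgt : tgt.toRingHom.Smooth

section ActionTriples

variable (𝒢 : LieGroupoid k R A) {M : Type u₃} [CommRing M] [Algebra k M] (μ : R →ₐ[k] M)

/-- The coordinate algebra `A ⊗[R] (A ⊗[R] M)` of the scheme of triples `(g, (h, x))` for which
`g (h x)` makes sense, given a moment map `μ`. -/
abbrev ActionTriples : Type (max u₂ u₃) :=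
  FibreProd 𝒢.src ((FibreProd.inl 𝒢.src μ).comp 𝒢.tgt)

/-- The entry `g` of the universal triple `(g, (h, x))`. -/
def actionTriple₁ : A →ₐ[k] ActionTriples 𝒢 μ := FibreProd.inl _ _

/-- The entry `h` of the universal triple `(g, (h, x))`. -/
def actionTriple₂ : A →ₐ[k] ActionTriples 𝒢 μ :=
  (FibreProd.inr _ _).comp (FibreProd.inl _ _)

/-- The entry `x` of the universal triple `(g, (h, x))`. -/
def actionTriple₃ : M →ₐ[k] ActionTriples 𝒢 μ :=
  (FibreProd.inr _ _).comp (FibreProd.inr _ _)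

theorem actionTriple₁₂ : (actionTriple₁ 𝒢 μ).comp 𝒢.src = (actionTriple₂ 𝒢 μ).comp 𝒢.tgt :=
  FibreProd.inl_comp _ _

theorem actionTriple₂₃ : (actionTriple₂ 𝒢 μ).comp 𝒢.src = (actionTriple₃ 𝒢 μ).comp μ := by
  rw [actionTriple₂, actionTriple₃, AlgHom.comp_assoc, FibreProd.inl_comp, AlgHom.comp_assoc]

end ActionTriples

/-- An affine `𝒢`-scheme structure on the affine scheme `Spec M`: a moment map
`Spec M → Spec R` and a coaction `M → A ⊗[R] M` (the comorphism of the action morphism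
`𝒢 ×[s, μ] Spec M → Spec M`) satisfying the three axioms of a left action. -/
structure Action (𝒢 : LieGroupoid k R A) (M : Type u₃) [CommRing M] [Algebra k M] where
  /-- the moment map -/
  moment : R →ₐ[k] M
  /-- the coaction -/
  coact : M →ₐ[k] FibreProd 𝒢.src moment
  /-- the moment map intertwines the action with the target -/
  coact_moment : coact.comp moment = (FibreProd.inl 𝒢.src moment).comp 𝒢.tgt
  /-- units act trivially -/
  one_coact : (FibreProd.lift (moment.comp 𝒢.one) (AlgHom.id k M)
    (by rw [AlgHom.comp_assoc, 𝒢.one_src]; rfl)).comp coact = AlgHom.id k M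
  /-- `(g h) x = g (h x)`, in the coordinate algebra of the triples `(g, (h, x))` -/
  coassoc :
    (FibreProd.lift
      (𝒢.prod (actionTriple₁ 𝒢 moment) (actionTriple₂ 𝒢 moment) (actionTriple₁₂ 𝒢 moment))
      (actionTriple₃ 𝒢 moment)
      ((𝒢.prod_src _ _ _).trans (actionTriple₂₃ 𝒢 moment))).comp coact =
    (FibreProd.mapRight 𝒢.src coact coact_moment).comp coact

end Groupoid

/-! ### Commuting actions -/

section Commuting

variable {k : Type*} [CommRing k] {R : Type u₁} {A : Type u₂} {R' : Type u₃} {A' : Type u₄}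
  {M : Type u₅} [CommRing R] [CommRing A] [CommRing R'] [CommRing A'] [CommRing M]
  [Algebra k R] [Algebra k A] [Algebra k R'] [Algebra k A'] [Algebra k M]
  {𝒢 : LieGroupoid k R A} {ℐ : LieGroupoid k R' A'}

/-- The exchange `A ⊗[R] (A' ⊗[R'] M) → A' ⊗[R'] (A ⊗[R] M)`, `a ⊗ (b ⊗ m) ↦ b ⊗ (a ⊗ m)`. -/
def swap (α : Action 𝒢 M) (β : Action ℐ M) :
    FibreProd 𝒢.src ((FibreProd.inr ℐ.src β.moment).comp α.moment) →ₐ[k]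
      FibreProd ℐ.src ((FibreProd.inr 𝒢.src α.moment).comp β.moment) :=
  FibreProd.lift
    ((FibreProd.inr _ _).comp (FibreProd.inl 𝒢.src α.moment))
    (FibreProd.lift (FibreProd.inl _ _)
      ((FibreProd.inr _ _).comp (FibreProd.inr 𝒢.src α.moment))
      (by rw [FibreProd.inl_comp, AlgHom.comp_assoc]))
    (by rw [← AlgHom.comp_assoc, FibreProd.lift_inr, AlgHom.comp_assoc, FibreProd.inl_comp,
          AlgHom.comp_assoc])

/-- Two actions on `Spec M` commute: each moment map is invariant under the other action, and
`g (h x) = h (g x)`. -/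
structure Commuting (α : Action 𝒢 M) (β : Action ℐ M) : Prop where
  moment_left_invariant :
    β.coact.comp α.moment = (FibreProd.inr ℐ.src β.moment).comp α.moment
  moment_right_invariant :
    α.coact.comp β.moment = (FibreProd.inr 𝒢.src α.moment).comp β.moment
  comm :
    (swap α β).comp ((FibreProd.mapRight 𝒢.src β.coact moment_left_invariant).comp α.coact) =
      (FibreProd.mapRight ℐ.src α.coact moment_right_invariant).comp β.coact

end Commuting

/-! ### Closed subgroupoids, their actions and their invariants -/

section Subgroupoid

variable {k : Type*} [CommRing k] {R : Type u₁} {A : Type u₂} {M : Type u₃}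
  [CommRing R] [CommRing A] [CommRing M] [Algebra k R] [Algebra k A] [Algebra k M]

/-- A closed subgroupoid `ℋ ⇉ S` of `Spec A ⇉ Spec R`: closed subvarieties `ℋ` and `S`, given by
radical ideals, such that all structure morphisms restrict. The (reduced) fibre product `ℋ ×[S] ℋ`
is cut out in `A ⊗[R] A` by the radical of the ideal generated by the equations of `ℋ` in both
factors. -/
structure ClosedSubgroupoid (𝒢 : LieGroupoid k R A) where
  /-- the ideal of `S` -/
  objects : Ideal R
  /-- the ideal of `ℋ` -/
  arrows : Ideal A
  objects_radical : objects.IsRadical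
  arrows_radical : arrows.IsRadical
  src_mem : objects ≤ arrows.comap 𝒢.src
  tgt_mem : objects ≤ arrows.comap 𝒢.tgt
  one_mem : arrows ≤ objects.comap 𝒢.one
  inv_mem : arrows ≤ arrows.comap 𝒢.inv
  mul_mem : arrows ≤ Ideal.comap 𝒢.mul
    (arrows.map (FibreProd.inl 𝒢.src 𝒢.tgt) ⊔ arrows.map (FibreProd.inr 𝒢.src 𝒢.tgt)).radical

namespace ClosedSubgroupoid

variable {𝒢 : LieGroupoid k R A} (H : ClosedSubgroupoid 𝒢)

/-- The source of `ℋ ⇉ S`. -/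
def srcH : R ⧸ H.objects →ₐ[k] A ⧸ H.arrows := Ideal.quotientMapₐ H.arrows 𝒢.src H.src_mem

/-- The target of `ℋ ⇉ S`. -/
def tgtH : R ⧸ H.objects →ₐ[k] A ⧸ H.arrows := Ideal.quotientMapₐ H.arrows 𝒢.tgt H.tgt_mem

variable (α : Action 𝒢 M)

/-- The ideal of the closed subscheme `μ⁻¹(S)` of `Spec M`. -/
def fibreIdeal : Ideal M := H.objects.map α.moment

/-- The coordinate algebra of `μ⁻¹(S)`. -/
abbrev Fibre : Type u₃ := M ⧸ H.fibreIdeal α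

/-- The comorphism of the inclusion of `μ⁻¹(S)` in `Spec M`. -/
def j : M →ₐ[k] H.Fibre α := Ideal.Quotient.mkₐ k _

/-- The moment map `μ⁻¹(S) → S`. -/
def momentH : R ⧸ H.objects →ₐ[k] H.Fibre α :=
  Ideal.quotientMapₐ (H.fibreIdeal α) α.moment Ideal.le_comap_map

theorem restrict_compat :
    ((FibreProd.inl H.srcH (H.momentH α)).comp (Ideal.Quotient.mkₐ k H.arrows)).comp 𝒢.src =
      ((FibreProd.inr H.srcH (H.momentH α)).comp (H.j α)).comp α.moment :=
  AlgHom.ext fun r =>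
    DFunLike.congr_fun (FibreProd.inl_comp H.srcH (H.momentH α)) (Ideal.Quotient.mk _ r)

/-- The restriction `A ⊗[R] M → k[ℋ] ⊗[k[S]] k[μ⁻¹(S)]`. -/
def restrict : FibreProd 𝒢.src α.moment →ₐ[k] FibreProd H.srcH (H.momentH α) :=
  FibreProd.lift
    ((FibreProd.inl H.srcH (H.momentH α)).comp (Ideal.Quotient.mkₐ k H.arrows))
    ((FibreProd.inr H.srcH (H.momentH α)).comp (H.j α))
    (H.restrict_compat α)

theorem restrict_coact_eq_zero (m : M) (hm : m ∈ H.fibreIdeal α) :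
    ((H.restrict α).comp α.coact) m = 0 := by
  suffices H.fibreIdeal α ≤ RingHom.ker ((H.restrict α).comp α.coact) from this hm
  refine Ideal.map_le_iff_le_comap.2 fun r hr => ?_
  have h₁ := DFunLike.congr_fun α.coact_moment r
  have h₂ : (H.restrict α) (FibreProd.inl 𝒢.src α.moment (𝒢.tgt r)) =
      FibreProd.inl H.srcH (H.momentH α) (Ideal.Quotient.mkₐ k H.arrows (𝒢.tgt r)) :=
    DFunLike.congr_fun (FibreProd.lift_inl _ _ (H.restrict_compat α)) (𝒢.tgt r)
  have h₃ : Ideal.Quotient.mkₐ k H.arrows (𝒢.tgt r) = 0 :=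
    Ideal.Quotient.eq_zero_iff_mem.2 (H.tgt_mem hr)
  simp only [AlgHom.comp_apply] at h₁
  rw [Ideal.mem_comap, RingHom.mem_ker, AlgHom.comp_apply, h₁, h₂, h₃, map_zero]

/-- The coaction `k[μ⁻¹(S)] → k[ℋ] ⊗[k[S]] k[μ⁻¹(S)]` of the action of `ℋ` on `μ⁻¹(S)`. -/
def coactH : H.Fibre α →ₐ[k] FibreProd H.srcH (H.momentH α) :=
  Ideal.Quotient.liftₐ (H.fibreIdeal α) ((H.restrict α).comp α.coact) (H.restrict_coact_eq_zero α)

/-- The algebra `k[μ⁻¹(S)]^ℋ` of `ℋ`-invariants; its spectrum is the reduction of `Spec M`. -/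
def invariants : Subalgebra k (H.Fibre α) :=
  AlgHom.equalizer (H.coactH α) (FibreProd.inr H.srcH (H.momentH α))

end ClosedSubgroupoid

end Subgroupoid

/-! ### The residual moment map -/

section Residual

variable {k : Type*} [CommRing k] {R : Type u₁} {A : Type u₂} {R' : Type u₃} {A' : Type u₄}
  {M : Type u₅} [CommRing R] [CommRing A] [CommRing R'] [CommRing A'] [CommRing M]
  [Algebra k R] [Algebra k A] [Algebra k R'] [Algebra k A'] [Algebra k M]
  {𝒢 : LieGroupoid k R A} {ℐ : LieGroupoid k R' A'}

/-- The restriction of the moment map of `α` to `ν⁻¹(S)`, where `ν` is the moment map of `β`. -/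
def momentFibre (α : Action 𝒢 M) (β : Action ℐ M) (H : ClosedSubgroupoid ℐ) :
    R →ₐ[k] H.Fibre β :=
  (H.j β).comp α.moment

theorem momentFibre_mem {α : Action 𝒢 M} {β : Action ℐ M} (h : Commuting α β)
    (H : ClosedSubgroupoid ℐ) (r : R) : momentFibre α β H r ∈ H.invariants β := by
  have h₁ : β.coact (α.moment r) = FibreProd.inr ℐ.src β.moment (α.moment r) :=
    DFunLike.congr_fun h.moment_left_invariant r
  have h₂ : (H.restrict β) (FibreProd.inr ℐ.src β.moment (α.moment r)) =
      FibreProd.inr H.srcH (H.momentH β) (H.j β (α.moment r)) :=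
    DFunLike.congr_fun (FibreProd.lift_inr _ _ (H.restrict_compat β)) (α.moment r)
  change (H.restrict β) (β.coact (α.moment r)) = _
  rw [h₁, h₂]
  rfl

/-- The residual moment map `Spec (k[ν⁻¹(S)]^ℋ) → Spec R`, the descent of `momentFibre`. -/
def momentResidual {α : Action 𝒢 M} {β : Action ℐ M} (h : Commuting α β)
    (H : ClosedSubgroupoid ℐ) : R →ₐ[k] H.invariants β :=
  (momentFibre α β H).codRestrict (H.invariants β) (momentFibre_mem h H)

/-- The inclusion-induced morphism `A ⊗[R] k[ν⁻¹(S)]^ℋ → A ⊗[R] k[ν⁻¹(S)]`. -/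
def residualIncl {α : Action 𝒢 M} {β : Action ℐ M} (h : Commuting α β)
    (H : ClosedSubgroupoid ℐ) :
    FibreProd 𝒢.src (momentResidual h H) →ₐ[k] FibreProd 𝒢.src (momentFibre α β H) :=
  FibreProd.mapRight 𝒢.src (H.invariants β).val rfl

/-- The bracket `Q` on `k[ν⁻¹(S)]^ℋ` is induced by the bracket `P` on `M`:
`{j^*f₁, j^*f₂} = j^*{f₁, f₂}` whenever `j^*f₁` and `j^*f₂` are `ℋ`-invariant. -/
def IsInducedBracket (H : ClosedSubgroupoid ℐ) (β : Action ℐ M) (P : M →ₗ[k] M →ₗ[k] M)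
    (Q : H.invariants β →ₗ[k] H.invariants β →ₗ[k] H.invariants β) : Prop :=
  ∀ (f₁ f₂ : M) (h₁ : H.j β f₁ ∈ H.invariants β) (h₂ : H.j β f₂ ∈ H.invariants β),
    (Q ⟨H.j β f₁, h₁⟩ ⟨H.j β f₂, h₂⟩ : H.Fibre β) = H.j β (P f₁ f₂)

end Residual

/-! ### Poisson brackets and coisotropic subschemes -/

section Poisson

variable {k : Type*} [CommRing k] {A B : Type*} [CommRing A] [Algebra k A] [CommRing B]
  [Algebra k B]

/-- A `k`-bilinear operation on a commutative algebra is a Poisson bracket. -/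
structure IsPoissonBracket (b : A →ₗ[k] A →ₗ[k] A) : Prop where
  self_eq_zero : ∀ f, b f f = 0
  jacobi : ∀ f g h, b f (b g h) + b g (b h f) + b h (b f g) = 0
  leibniz : ∀ f g h, b f (g * h) = b f g * h + g * b f h

/-- The closed subscheme of an ideal is coisotropic: the ideal is closed under the bracket. -/
def IsCoisotropic (b : A →ₗ[k] A →ₗ[k] A) (I : Ideal A) : Prop :=
  ∀ f ∈ I, ∀ g ∈ I, b f g ∈ I

/-- The bracket of a product: `{f ⊗ g, f' ⊗ g'} = {f, f'} ⊗ g g' + f f' ⊗ {g, g'}`. -/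
def prodBracket (a : A →ₗ[k] A →ₗ[k] A) (b : B →ₗ[k] B →ₗ[k] B) :
    A ⊗[k] B →ₗ[k] A ⊗[k] B →ₗ[k] A ⊗[k] B :=
  TensorProduct.map₂ a (LinearMap.mul k B) + TensorProduct.map₂ (LinearMap.mul k A) b

end Poisson

/-! ### Symplectic forms and affine symplectic groupoids -/

section Symplectic

variable {k : Type*} [CommRing k]

/-- An algebraic symplectic form on the smooth affine variety `Spec A`: a closed nondegenerate
alternating `A`-bilinear form on vector fields (`A` being smooth, these are the same as the
elements of `Ω²`). -/
structure SymplecticForm (k : Type*) [CommRing k] (A : Type*) [CommRing A] [Algebra k A] where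
  /-- the form -/
  form : Derivation k A A →ₗ[A] Derivation k A A →ₗ[A] A
  alternating : ∀ D, form D D = 0
  nondegenerate : Function.Bijective form
  closed : ∀ D E F : Derivation k A A,
    D (form E F) - E (form D F) + F (form D E)
      - form ⁅D, E⁆ F + form ⁅D, F⁆ E - form ⁅E, F⁆ D = 0

namespace SymplecticForm

variable {A : Type*} [CommRing A] [Algebra k A] (ω : SymplecticForm k A)

/-- The differential `df` as a linear function `D ↦ D f` on vector fields. -/
def differential (f : A) : Derivation k A A →ₗ[A] A where
  toFun D := D f
  map_add' _ _ := rfl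
  map_smul' _ _ := rfl

/-- The Hamiltonian vector field `X_f` of `f`, defined by `ω(X_f, ·) = df`. -/
def ham (f : A) : Derivation k A A :=
  (LinearEquiv.ofBijective ω.form ω.nondegenerate).symm (differential f)

theorem form_ham (f : A) (D : Derivation k A A) : ω.form (ω.ham f) D = D f :=
  DFunLike.congr_fun
    ((LinearEquiv.ofBijective ω.form ω.nondegenerate).apply_symm_apply (differential f)) D

theorem ham_add (f g : A) : ω.ham (f + g) = ω.ham f + ω.ham g := by
  apply ω.nondegenerate.1
  ext D
  simp [form_ham]

theorem ham_smul (c : k) (f : A) : ω.ham (c • f) = c • ω.ham f := by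
  apply ω.nondegenerate.1
  ext D
  have h : c • ω.ham f = algebraMap k A c • ω.ham f := (algebraMap_smul A c (ω.ham f)).symm
  have h' : ω.form (algebraMap k A c • ω.ham f) D = algebraMap k A c • ω.form (ω.ham f) D := by
    rw [LinearMap.map_smul, LinearMap.smul_apply]
  rw [form_ham, h, h', form_ham, Derivation.map_smul, algebraMap_smul]

/-- The Poisson bracket `{f, g} = ω(X_f, X_g) = X_g f` of a symplectic form. -/
def bracket : A →ₗ[k] A →ₗ[k] A :=
  LinearMap.mk₂ k (fun f g => ω.ham g f)
    (fun _ _ _ => Derivation.map_add _ _ _) (fun _ _ _ => Derivation.map_smul _ _ _)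
    (fun _ _ _ => by rw [ham_add]; rfl) (fun _ _ _ => by rw [ham_smul]; rfl)

theorem bracket_apply (f g : A) : ω.bracket f g = ω.form (ω.ham f) (ω.ham g) :=
  (ω.form_ham f (ω.ham g)).symm

end SymplecticForm

variable {R : Type u₁} {A : Type u₂} [CommRing R] [CommRing A] [Algebra k R] [Algebra k A]

/-- The symplectic form `ω` makes `𝒢` an affine symplectic groupoid: the graph of multiplication
is coisotropic in `𝒢 × 𝒢 × 𝒢⁻`. -/
def IsSymplecticGroupoid (𝒢 : LieGroupoid k R A) (ω : SymplecticForm k A) : Prop :=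
  IsCoisotropic (prodBracket (prodBracket ω.bracket ω.bracket) (-ω.bracket))
    (FibreProd.graphIdeal 𝒢.mul)

/-- The action `α` is Hamiltonian for the bracket `b` on `M`: its graph is coisotropic in
`𝒢 × Spec M × (Spec M)⁻`. -/
def IsHamiltonian {M : Type u₃} [CommRing M] [Algebra k M] {𝒢 : LieGroupoid k R A}
    (ω : SymplecticForm k A) (α : Action 𝒢 M) (b : M →ₗ[k] M →ₗ[k] M) : Prop :=
  IsCoisotropic (prodBracket (prodBracket ω.bracket b) (-b)) (FibreProd.graphIdeal α.coact)

/-- The Poisson bracket on the base of a symplectic groupoid for which the target is a Poisson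
morphism. As the target comorphism is split injective with left inverse the comorphism of the
units, it can only be `{f, h} = 1^*{t^*f, t^*h}`. -/
def baseBracket (𝒢 : LieGroupoid k R A) (ω : SymplecticForm k A) : R →ₗ[k] R →ₗ[k] R :=
  (ω.bracket.compl₁₂ 𝒢.tgt.toLinearMap 𝒢.tgt.toLinearMap).compr₂ 𝒢.one.toLinearMap

theorem baseBracket_apply (𝒢 : LieGroupoid k R A) (ω : SymplecticForm k A) (f h : R) :
    baseBracket 𝒢 ω f h = 𝒢.one (ω.bracket (𝒢.tgt f) (𝒢.tgt h)) := rfl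

/-- The derivation `f ↦ {f, h}` of the base. -/
def baseDerivation (𝒢 : LieGroupoid k R A) (ω : SymplecticForm k A) (h : R) :
    Derivation k R R :=
  Derivation.mk' ((baseBracket 𝒢 ω).flip h) (fun f g => by
    have e : ∀ r, 𝒢.one (𝒢.tgt r) = r := fun r => DFunLike.congr_fun 𝒢.one_tgt r
    change 𝒢.one (ω.ham (𝒢.tgt h) (𝒢.tgt (f * g))) =
      f • 𝒢.one (ω.ham (𝒢.tgt h) (𝒢.tgt g)) + g • 𝒢.one (ω.ham (𝒢.tgt h) (𝒢.tgt f))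
    simp [Derivation.leibniz, e])

/-- The function `σ(a)(h)`, where `σ : T^* → T` is contraction with the Poisson bivector field of
the base, determined by `σ(df)(h) = {f, h}`. -/
def sharp (𝒢 : LieGroupoid k R A) (ω : SymplecticForm k A) (a : Ω[R⁄k]) (h : R) : R :=
  (baseDerivation 𝒢 ω h).liftKaehlerDifferential a

/-- The `1`-form `a` restricts to a section over `S` of the conormal bundle of `S`: it vanishes
along `S` on the vector fields tangent to `S`. -/
def IsConormal (I : Ideal R) (a : Ω[R⁄k]) : Prop :=
  ∀ F : Derivation k R R, (∀ h ∈ I, F h ∈ I) → F.liftKaehlerDifferential a ∈ I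

namespace ClosedSubgroupoid

variable {𝒢 : LieGroupoid k R A} (H : ClosedSubgroupoid 𝒢)

/-- Along the units over `S`, the vector field `D` restricts to a section of the Lie algebroid
`ker (ds)` of `ℋ`: there it is tangent to the source fibres and to `ℋ`. Every section over `S` of
the Lie algebroid of `ℋ` is of this form, as `Spec A` is affine and smooth. -/
def IsLieSection (D : Derivation k A A) : Prop :=
  (∀ f, 𝒢.one (D (𝒢.src f)) ∈ H.objects) ∧ ∀ a ∈ H.arrows, 𝒢.one (D a) ∈ H.objects

/-- The covector field `ω(D, d1(·))` on the base coincides with the `1`-form `a` along `S`. A vector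
field `F` on the base is pushed forward by the units by means of an extension `E` of `d1(F)`. -/
def Corresponds (ω : SymplecticForm k A) (D : Derivation k A A) (a : Ω[R⁄k]) : Prop :=
  ∀ (E : Derivation k A A) (F : Derivation k R R), (∀ g, 𝒢.one (E g) = F (𝒢.one g)) →
    𝒢.one (ω.form D E) - F.liftKaehlerDifferential a ∈ H.objects

/-- `ℋ ⇉ S` is a stabilizer subgroupoid of the symplectic groupoid `𝒢`: it is an algebraic Lie
groupoid, the symplectic form pulls back to zero on `ℋ`, and the sections of its Lie algebroid,
seen in the cotangent bundle of the base through `v ↦ ω(v, d1(·))`, are those of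
`N^*S ∩ σ⁻¹(TS)`. -/
structure IsStabilizer (ω : SymplecticForm k A) : Prop where
  smooth_objects : Algebra.Smooth k (R ⧸ H.objects)
  smooth_arrows : Algebra.Smooth k (A ⧸ H.arrows)
  smooth_src : H.srcH.toRingHom.Smooth
  smooth_tgt : H.tgtH.toRingHom.Smooth
  /-- vector fields tangent to `ℋ` are pairwise orthogonal along `ℋ` -/
  isotropic : ∀ D E : Derivation k A A, (∀ a ∈ H.arrows, D a ∈ H.arrows) →
    (∀ a ∈ H.arrows, E a ∈ H.arrows) → ω.form D E ∈ H.arrows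
  lieAlgebroid : ∀ a : Ω[R⁄k],
    (∃ D, H.IsLieSection D ∧ H.Corresponds ω D a) ↔
      (IsConormal H.objects a ∧ ∀ h ∈ H.objects, sharp 𝒢 ω a h ∈ H.objects)

end ClosedSubgroupoid

end Symplectic

end AffineGroupoid

end

/-!
# Reduction of affine Hamiltonian schemes along subgroupoids

*The residual action.* The action of `𝒢` restricts to `ν⁻¹(S)` because `ν` is `𝒢`-invariant
(`coactFibre`), and it commutes there with the action of `ℋ`
(`mapRight_coactH_comp_coactFibre`). The `ℋ`-invariants are the equalizer of two morphisms over the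
base of `𝒢`. As the source map of `𝒢` is smooth, hence flat, base change along it preserves this
equalizer and injectivity. So the coaction maps invariants to invariants
(`coactFibre_mem_range`), and the axioms for the restricted coaction can be tested on `ν⁻¹(S)`
(`residualAction`).

*Symplectic groupoids.* A morphism with coisotropic graph is computed on brackets by the product
bracket of any representatives (`map_bracket_of_isCoisotropic_graphIdeal`). For the multiplication
this shows that functions pulled back along source and target commute, that the Hamiltonian vector
fields of the latter are right-invariant and those of the former left-invariant, and that the
units are coisotropic. The last fact is the splitting
`1^*{a, b} = 1^*{a, s^*1^*b} + 1^*{t^*1^*a, b}` (`IsSymplecticGroupoid.one_bracket`), which replaces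
all counts of dimensions. Together with the fact that Hamiltonian vector fields span the tangent
spaces and with left translations, it shows that the kernel of the differential of the target is
spanned by the Hamiltonian vector fields of functions pulled back along the source
(`exists_eq_sum_bracket_src`).

*A stabilizer `ℋ` is coisotropic.* For `s` vanishing on the coisotropic `S`, the covector `ds` lies
in the Lie algebroid of `ℋ`, so that `X_{t^*s}` and `X_{s^*s}` are tangent to `ℋ` at the units, and
by invariance everywhere (`bracket_tgt_mem`, `bracket_src_mem`). If `a` vanishes on `ℋ`, then `X_a`
maps under the differential of the target to a vector tangent to `S`; as `ℋ → S` is smooth, one may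
subtract from `X_a` a vector field tangent to `ℋ` so that the difference `V` is tangent to the
target fibres, and thus a combination of fields `X_{s^*r}`. Both `X_a` and the vectors tangent to
`ℋ` are orthogonal to the tangent space of `ℋ`, by isotropy. So `V` is too, which forces `V` to be
tangent to `ℋ` (`IsStabilizer.isCoisotropic`).

*The Poisson structure.* The Hamiltonian condition identifies `{ν^*s, ·}` with the infinitesimal
action of a section of the Lie algebroid of `ℋ`, so it kills functions with invariant restriction
modulo the ideal of `ν⁻¹(S)` (`bracket_moment_mem`). Since `ℋ` is coisotropic, these functions are
closed under the bracket (`bracket_mem_invariants`). Hence the ideal of `ν⁻¹(S)` is a Poisson ideal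
in the Poisson algebra which they form, and the bracket descends. The graph of the residual action
is coisotropic because its equations lift to equations of the original graph, up to the ideal of
`ν⁻¹(S)` (`IsHamiltonian.reduction`).
-/

noncomputable section

namespace AffineGroupoid

universe u₁ u₂ u₃ u₄ u₅

/-! ### Morphisms out of fibre products, and flat base change -/

namespace FibreProd

variable {k : Type*} {R : Type u₁} {B : Type u₂} {C : Type u₃} {D : Type u₄} {E : Type u₅}
variable [CommRing k] [CommRing R] [CommRing B] [CommRing C] [CommRing D] [CommRing E]
variable [Algebra k R] [Algebra k B] [Algebra k C] [Algebra k D] [Algebra k E]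

/-- The surjection `B ⊗[k] C → B ⊗[R] C`, the comorphism of the inclusion of the fibre product over
`Spec R` in the product. -/
def ofTensor (σ : R →ₐ[k] B) (τ : R →ₐ[k] C) : B ⊗[k] C →ₐ[k] FibreProd σ τ :=
  Algebra.TensorProduct.productMap (inl σ τ) (inr σ τ)

@[simp] theorem ofTensor_tmul (σ : R →ₐ[k] B) (τ : R →ₐ[k] C) (b : B) (c : C) :
    ofTensor σ τ (b ⊗ₜ c) = inl σ τ b * inr σ τ c := by
  simp [ofTensor]

theorem ofTensor_surjective (σ : R →ₐ[k] B) (τ : R →ₐ[k] C) :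
    Function.Surjective (ofTensor σ τ) := by
  let _ := σ.toRingHom.toAlgebra
  let _ := τ.toRingHom.toAlgebra
  intro x
  change B ⊗[R] C at x
  induction x using TensorProduct.induction_on with
  | zero => exact ⟨0, map_zero _⟩
  | tmul b c =>
    refine ⟨b ⊗ₜ c, ?_⟩
    rw [ofTensor_tmul]
    exact (Algebra.TensorProduct.tmul_mul_tmul (R := R) b 1 1 c).trans (by rw [mul_one, one_mul])
  | add x y hx hy =>
    obtain ⟨x', hx⟩ := hx
    obtain ⟨y', hy⟩ := hy
    exact ⟨x' + y', by rw [map_add, hx, hy]; rfl⟩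

theorem inl_comp_apply (σ : R →ₐ[k] B) (τ : R →ₐ[k] C) (r : R) :
    inl σ τ (σ r) = inr σ τ (τ r) :=
  DFunLike.congr_fun (inl_comp σ τ) r

theorem hom_ext {σ : R →ₐ[k] B} {τ : R →ₐ[k] C} {f g : FibreProd σ τ →ₐ[k] D}
    (hl : f.comp (inl σ τ) = g.comp (inl σ τ)) (hr : f.comp (inr σ τ) = g.comp (inr σ τ)) :
    f = g := by
  have h : f.comp (ofTensor σ τ) = g.comp (ofTensor σ τ) := by
    apply Algebra.TensorProduct.ext'
    intro b c
    have h₁ := DFunLike.congr_fun hl b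
    have h₂ := DFunLike.congr_fun hr c
    simp only [AlgHom.comp_apply] at h₁ h₂
    simp [h₁, h₂]
  ext x
  obtain ⟨x, rfl⟩ := ofTensor_surjective σ τ x
  exact DFunLike.congr_fun h x

section Lift

variable {σ : R →ₐ[k] B} {τ : R →ₐ[k] C}

@[simp] theorem lift_inl_apply (f : B →ₐ[k] D) (g : C →ₐ[k] D) (w : f.comp σ = g.comp τ) (b : B) :
    lift f g w (inl σ τ b) = f b :=
  DFunLike.congr_fun (lift_inl f g w) b

@[simp] theorem lift_inr_apply (f : B →ₐ[k] D) (g : C →ₐ[k] D) (w : f.comp σ = g.comp τ) (c : C) :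
    lift f g w (inr σ τ c) = g c :=
  DFunLike.congr_fun (lift_inr f g w) c

theorem lift_ofTensor (f : B →ₐ[k] D) (g : C →ₐ[k] D) (w : f.comp σ = g.comp τ) (z : B ⊗[k] C) :
    lift f g w (ofTensor σ τ z) = Algebra.TensorProduct.productMap f g z := by
  have : (lift f g w).comp (ofTensor σ τ) = Algebra.TensorProduct.productMap f g :=
    Algebra.TensorProduct.ext' fun b c => by simp
  exact DFunLike.congr_fun this z

theorem comp_lift (h : D →ₐ[k] E) (f : B →ₐ[k] D) (g : C →ₐ[k] D) (w : f.comp σ = g.comp τ) :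
    h.comp (lift f g w) =
      lift (h.comp f) (h.comp g) (by rw [AlgHom.comp_assoc, w, AlgHom.comp_assoc]) := by
  apply hom_ext <;> ext <;> simp

end Lift

section MapRight

variable (σ : R →ₐ[k] B) {τ : R →ₐ[k] C} {τ' : R →ₐ[k] D}

@[simp] theorem mapRight_inl_apply (g : C →ₐ[k] D) (w : g.comp τ = τ') (b : B) :
    mapRight σ g w (inl σ τ b) = inl σ τ' b := by
  simp [mapRight]

@[simp] theorem mapRight_inr_apply (g : C →ₐ[k] D) (w : g.comp τ = τ') (c : C) :
    mapRight σ g w (inr σ τ c) = inr σ τ' (g c) := by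
  simp [mapRight]

/-- The kernel of `id ⊗ g` for a surjection `g` with kernel `J` is generated by `1 ⊗ J`. -/
theorem ker_mapRight_le (g : C →ₐ[k] D) (w : g.comp τ = τ') (hg : Function.Surjective g) :
    RingHom.ker (mapRight σ g w) ≤ (RingHom.ker g).map (inr σ τ) := by
  -- the quotient by the right hand side receives a morphism from `B ⊗[R] D`
  set J := (RingHom.ker g).map (inr σ τ)
  let q := Ideal.Quotient.mkₐ k J
  let p : D →ₐ[k] FibreProd σ τ ⧸ J :=
    (Ideal.Quotient.liftₐ (RingHom.ker g) (q.comp (inr σ τ)) fun c hc =>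
      Ideal.Quotient.eq_zero_iff_mem.2 (Ideal.mem_map_of_mem _ hc)).comp
      (Ideal.quotientKerAlgEquivOfSurjective hg).symm.toAlgHom
  have hp : p.comp g = q.comp (inr σ τ) := by
    ext c
    have : (Ideal.quotientKerAlgEquivOfSurjective hg).symm (g c) = Ideal.Quotient.mk _ c := by
      rw [AlgEquiv.symm_apply_eq]
      rfl
    simp only [p, AlgHom.comp_apply]
    exact (congrArg _ this).trans rfl
  let Ψ : FibreProd σ τ' →ₐ[k] FibreProd σ τ ⧸ J :=
    lift (q.comp (inl σ τ)) p (by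
      rw [AlgHom.comp_assoc, inl_comp, ← w, ← AlgHom.comp_assoc, ← AlgHom.comp_assoc, hp])
  have hΨ : Ψ.comp (mapRight σ g w) = q := by
    apply hom_ext
    · ext b; simp [Ψ]
    · ext c
      have := DFunLike.congr_fun hp c
      simpa [Ψ] using! this
  intro x hx
  have h₁ := DFunLike.congr_fun hΨ x
  rw [AlgHom.comp_apply, (RingHom.mem_ker).1 hx, map_zero] at h₁
  exact Ideal.Quotient.eq_zero_iff_mem.1 h₁.symm

/-- A morphism of schemes over `Spec R` as an `R`-linear map between coordinate algebras. -/
def toLinear (g : C →ₐ[k] D) (w : g.comp τ = τ') :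
    letI := τ.toRingHom.toAlgebra
    letI := τ'.toRingHom.toAlgebra
    C →ₗ[R] D :=
  letI := τ.toRingHom.toAlgebra
  letI := τ'.toRingHom.toAlgebra
  { toFun := g
    map_add' := map_add g
    map_smul' := fun r c => by
      rw [Algebra.smul_def, Algebra.smul_def, map_mul]
      exact congrArg (· * g c) (DFunLike.congr_fun w r) }

theorem mapRight_apply (g : C →ₐ[k] D) (w : g.comp τ = τ') (x : FibreProd σ τ) :
    letI := σ.toRingHom.toAlgebra
    letI := τ.toRingHom.toAlgebra
    letI := τ'.toRingHom.toAlgebra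
    mapRight σ g w x = (toLinear g w).lTensor B x := by
  let _ := σ.toRingHom.toAlgebra
  let _ := τ.toRingHom.toAlgebra
  let _ := τ'.toRingHom.toAlgebra
  obtain ⟨x, rfl⟩ := ofTensor_surjective σ τ x
  induction x using TensorProduct.induction_on with
  | zero => exact (map_zero _).trans (map_zero ((toLinear g w).lTensor B)).symm
  | tmul b c =>
    have e₁ : inl σ τ b * inr σ τ c = (b ⊗ₜ[R] c : B ⊗[R] C) :=
      (Algebra.TensorProduct.tmul_mul_tmul (R := R) b 1 1 c).trans (by rw [mul_one, one_mul])
    have e₂ : inl σ τ' b * inr σ τ' (g c) = (b ⊗ₜ[R] g c : B ⊗[R] D) :=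
      (Algebra.TensorProduct.tmul_mul_tmul (R := R) b 1 1 (g c)).trans (by rw [mul_one, one_mul])
    rw [ofTensor_tmul, map_mul, mapRight_inl_apply, mapRight_inr_apply, e₁, e₂]
    exact (LinearMap.lTensor_tmul B (toLinear g w) b c).symm
  | add x y hx hy =>
    rw [map_add, map_add, hx, hy]
    exact (map_add ((toLinear g w).lTensor B) _ _).symm

/-- Flat base change preserves injectivity of comorphisms. -/
theorem mapRight_injective (hσ : σ.toRingHom.Flat) (g : C →ₐ[k] D) (w : g.comp τ = τ')
    (hg : Function.Injective g) : Function.Injective (mapRight σ g w) := by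
  let _ := σ.toRingHom.toAlgebra
  let _ := τ.toRingHom.toAlgebra
  let _ := τ'.toRingHom.toAlgebra
  have : Module.Flat R B := hσ
  intro x y hxy
  rw [mapRight_apply, mapRight_apply] at hxy
  exact Module.Flat.lTensor_preserves_injective_linearMap (toLinear g w) hg hxy

/-- Flat base change preserves equalizers of comorphisms. -/
theorem mem_range_mapRight (hσ : σ.toRingHom.Flat) {τ'' : R →ₐ[k] E} (g : C →ₐ[k] D)
    (w : g.comp τ = τ') (p q : D →ₐ[k] E) (wp : p.comp τ' = τ'') (wq : q.comp τ' = τ'')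
    (h : ∀ d, p d = q d ↔ d ∈ g.range) {x : FibreProd σ τ'}
    (hx : mapRight σ p wp x = mapRight σ q wq x) : x ∈ (mapRight σ g w).range := by
  let _ := σ.toRingHom.toAlgebra
  let _ := τ.toRingHom.toAlgebra
  let _ := τ'.toRingHom.toAlgebra
  let _ := τ''.toRingHom.toAlgebra
  have : Module.Flat R B := hσ
  have hex : Function.Exact (toLinear g w) (toLinear p wp - toLinear q wq) := fun d =>
    sub_eq_zero.trans (h d)
  rw [mapRight_apply, mapRight_apply] at hx
  have hx' : (toLinear p wp - toLinear q wq).lTensor B x = 0 := by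
    rw [LinearMap.lTensor_sub]
    exact sub_eq_zero.2 hx
  obtain ⟨y, hy⟩ := (Module.Flat.lTensor_exact B hex x).1 hx'
  exact ⟨y, (mapRight_apply σ g w y).trans hy⟩

end MapRight

end FibreProd

/-! ### Transport of actions along surjections and injections -/

section Transport

variable {k : Type*} [CommRing k] {R : Type u₁} {A : Type u₂} [CommRing R]
    [CommRing A] [Algebra k R] [Algebra k A]

theorem PreGroupoid.comp_prod (𝒢 : PreGroupoid k R A) {D : Type u₃} {E : Type u₄} [CommRing D]
    [Algebra k D] [CommRing E] [Algebra k E] (f : D →ₐ[k] E) (g h : A →ₐ[k] D)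
    (w : g.comp 𝒢.src = h.comp 𝒢.tgt) :
    f.comp (𝒢.prod g h w) = 𝒢.prod (f.comp g) (f.comp h)
      (by rw [AlgHom.comp_assoc, w, AlgHom.comp_assoc]) := by
  rw [PreGroupoid.prod, PreGroupoid.prod, ← AlgHom.comp_assoc, FibreProd.comp_lift]

theorem PreGroupoid.prod_congr (𝒢 : PreGroupoid k R A) {D : Type u₃} [CommRing D]
    [Algebra k D] {g h g' h' : A →ₐ[k] D} (hg : g = g') (hh : h = h')
    (w : g.comp 𝒢.src = h.comp 𝒢.tgt) :
    𝒢.prod g h w = 𝒢.prod g' h' (by rw [← hg, ← hh, w]) := by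
  subst hg hh; rfl

variable {M : Type u₃} {N : Type u₄} [CommRing M] [Algebra k M] [CommRing N] [Algebra k N]

/-- The comorphism `a ⊗ (b ⊗ m) ↦ a ⊗ (b ⊗ f m)` between schemes of triples `(g, (h, x))`. -/
def mapTriples (𝒢 : LieGroupoid k R A) {μ : R →ₐ[k] M} {ν : R →ₐ[k] N} (f : M →ₐ[k] N)
    (hf : f.comp μ = ν) : ActionTriples 𝒢 μ →ₐ[k] ActionTriples 𝒢 ν :=
  FibreProd.mapRight 𝒢.src (FibreProd.mapRight 𝒢.src f hf) (by
    ext; simp)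

section Naturality

variable {𝒢 : LieGroupoid k R A} {μ : R →ₐ[k] M} {ν : R →ₐ[k] N}
  {f : M →ₐ[k] N} (hf : f.comp μ = ν) {φ : M →ₐ[k] FibreProd 𝒢.src μ}
  {ψ : N →ₐ[k] FibreProd 𝒢.src ν} (h : (FibreProd.mapRight 𝒢.src f hf).comp φ = ψ.comp f)

include h

theorem mapTriples_comp_left :
    (mapTriples 𝒢 f hf).comp ((FibreProd.lift
      (𝒢.prod (actionTriple₁ 𝒢 μ) (actionTriple₂ 𝒢 μ) (actionTriple₁₂ 𝒢 μ))
      (actionTriple₃ 𝒢 μ) ((𝒢.prod_src _ _ _).trans (actionTriple₂₃ 𝒢 μ))).comp φ) =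
    ((FibreProd.lift
      (𝒢.prod (actionTriple₁ 𝒢 ν) (actionTriple₂ 𝒢 ν) (actionTriple₁₂ 𝒢 ν))
      (actionTriple₃ 𝒢 ν) ((𝒢.prod_src _ _ _).trans (actionTriple₂₃ 𝒢 ν))).comp ψ).comp f := by
  have h₁ : (mapTriples 𝒢 f hf).comp (actionTriple₁ 𝒢 μ) = actionTriple₁ 𝒢 ν := by
    ext; simp [mapTriples, actionTriple₁]
  have h₂ : (mapTriples 𝒢 f hf).comp (actionTriple₂ 𝒢 μ) = actionTriple₂ 𝒢 ν := by
    ext; simp [mapTriples, actionTriple₂]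
  have h₃ : (mapTriples 𝒢 f hf).comp (actionTriple₃ 𝒢 μ) = (actionTriple₃ 𝒢 ν).comp f := by
    ext; simp [mapTriples, actionTriple₃]
  rw [AlgHom.comp_assoc, ← h, ← AlgHom.comp_assoc, ← AlgHom.comp_assoc]
  congr 1
  apply FibreProd.hom_ext
  · rw [AlgHom.comp_assoc, FibreProd.lift_inl, PreGroupoid.comp_prod,
      𝒢.prod_congr h₁ h₂]
    ext; simp
  · rw [AlgHom.comp_assoc, FibreProd.lift_inr, h₃]
    ext; simp

theorem mapTriples_comp_right
    (hφ : φ.comp μ = (FibreProd.inl 𝒢.src μ).comp 𝒢.tgt)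
    (hψ : ψ.comp ν = (FibreProd.inl 𝒢.src ν).comp 𝒢.tgt) :
    (mapTriples 𝒢 f hf).comp ((FibreProd.mapRight 𝒢.src φ hφ).comp φ) =
    ((FibreProd.mapRight 𝒢.src ψ hψ).comp ψ).comp f := by
  rw [AlgHom.comp_assoc, ← h, ← AlgHom.comp_assoc, ← AlgHom.comp_assoc]
  congr 1
  apply FibreProd.hom_ext
  · ext; simp [mapTriples]
  · ext m
    have := DFunLike.congr_fun h m
    simp only [AlgHom.comp_apply] at this
    simp [mapTriples, this]

theorem lift_one_comp (w₁ : (μ.comp 𝒢.one).comp 𝒢.src = (AlgHom.id k M).comp μ)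
    (w₂ : (ν.comp 𝒢.one).comp 𝒢.src = (AlgHom.id k N).comp ν) :
    f.comp ((FibreProd.lift (μ.comp 𝒢.one) (AlgHom.id k M) w₁).comp φ) =
      ((FibreProd.lift (ν.comp 𝒢.one) (AlgHom.id k N) w₂).comp ψ).comp f := by
  rw [AlgHom.comp_assoc, ← h, ← AlgHom.comp_assoc, ← AlgHom.comp_assoc]
  congr 1
  subst hf
  apply FibreProd.hom_ext <;> ext <;> simp

end Naturality

/-- An action on `Spec M` restricts to a closed subscheme `Spec N` as soon as its coaction
descends. -/
def Action.ofSurjective {𝒢 : LieGroupoid k R A} (α : Action 𝒢 M) (f : M →ₐ[k] N)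
    (hf : Function.Surjective f) (φ : N →ₐ[k] FibreProd 𝒢.src (f.comp α.moment))
    (h : φ.comp f = (FibreProd.mapRight 𝒢.src f rfl).comp α.coact) : Action 𝒢 N where
  moment := f.comp α.moment
  coact := φ
  coact_moment := by
    rw [← AlgHom.comp_assoc, h, AlgHom.comp_assoc, α.coact_moment]
    ext; simp
  one_coact := by
    rw [← AlgHom.cancel_right hf, ← lift_one_comp rfl h.symm
      (by rw [AlgHom.comp_assoc, 𝒢.one_src]; rfl), α.one_coact]
    rfl
  coassoc := by
    rw [← AlgHom.cancel_right hf, ← mapTriples_comp_left rfl h.symm, α.coassoc,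
      mapTriples_comp_right rfl h.symm]

/-- An action on `Spec N` descends along a dominant morphism `Spec N → Spec M` as soon as its
coaction restricts; the axioms are tested after flat base change along the source. -/
def Action.ofInjective {𝒢 : LieGroupoid k R A} (α : Action 𝒢 N) (f : M →ₐ[k] N)
    (hf : Function.Injective f) (μ : R →ₐ[k] M) (hμ : f.comp μ = α.moment)
    (φ : M →ₐ[k] FibreProd 𝒢.src μ)
    (h : (FibreProd.mapRight 𝒢.src f hμ).comp φ = α.coact.comp f) : Action 𝒢 M where
  moment := μ
  coact := φ
  coact_moment := by
    rw [← AlgHom.cancel_left (FibreProd.mapRight_injective 𝒢.src 𝒢.smooth_src.flat f hμ hf),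
      ← AlgHom.comp_assoc, h, AlgHom.comp_assoc, hμ, α.coact_moment]
    ext; simp
  one_coact := by
    rw [← AlgHom.cancel_left hf, lift_one_comp hμ h _
      (by rw [AlgHom.comp_assoc, 𝒢.one_src]; rfl), α.one_coact]
    rfl
  coassoc := by
    have hinj : Function.Injective (mapTriples 𝒢 f hμ) :=
      FibreProd.mapRight_injective 𝒢.src 𝒢.smooth_src.flat _ _
        (FibreProd.mapRight_injective 𝒢.src 𝒢.smooth_src.flat f hμ hf)
    have hφ : φ.comp μ = (FibreProd.inl 𝒢.src μ).comp 𝒢.tgt := by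
      rw [← AlgHom.cancel_left (FibreProd.mapRight_injective 𝒢.src 𝒢.smooth_src.flat f hμ hf),
        ← AlgHom.comp_assoc, h, AlgHom.comp_assoc, hμ, α.coact_moment]
      ext; simp
    rw [← AlgHom.cancel_left hinj, mapTriples_comp_left hμ h, α.coassoc,
      mapTriples_comp_right hμ h hφ α.coact_moment]

end Transport

/-! ### The residual action -/

section Residual

variable {k : Type*} [CommRing k] {R : Type u₁} {A : Type u₂} {R' : Type u₃} {A' : Type u₄}
  {M : Type u₅} [CommRing R] [CommRing A] [CommRing R'] [CommRing A'] [CommRing M]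
  [Algebra k R] [Algebra k A] [Algebra k R'] [Algebra k A'] [Algebra k M]
  {𝒢 : LieGroupoid k R A} {ℐ : LieGroupoid k R' A'}

theorem ClosedSubgroupoid.j_surjective (H : ClosedSubgroupoid ℐ) (β : Action ℐ M) :
    Function.Surjective (H.j β) :=
  Ideal.Quotient.mkₐ_surjective k _

theorem ClosedSubgroupoid.j_eq_zero_iff (H : ClosedSubgroupoid ℐ) (β : Action ℐ M) {m : M} :
    H.j β m = 0 ↔ m ∈ H.fibreIdeal β :=
  Ideal.Quotient.eq_zero_iff_mem

theorem ClosedSubgroupoid.j_moment (H : ClosedSubgroupoid ℐ) (β : Action ℐ M) {r : R'}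
    (hr : r ∈ H.objects) : H.j β (β.moment r) = 0 :=
  (H.j_eq_zero_iff β).2 (Ideal.mem_map_of_mem _ hr)

theorem ClosedSubgroupoid.coactH_comp_j (H : ClosedSubgroupoid ℐ) (β : Action ℐ M) :
    (H.coactH β).comp (H.j β) = (H.restrict β).comp β.coact :=
  AlgHom.ext fun _ => rfl

theorem ClosedSubgroupoid.mem_invariants (H : ClosedSubgroupoid ℐ) (β : Action ℐ M)
    {b : H.Fibre β} : b ∈ H.invariants β ↔ H.coactH β b = FibreProd.inr _ _ b :=
  Iff.rfl

@[simp] theorem ClosedSubgroupoid.restrict_inl_apply (H : ClosedSubgroupoid ℐ) (β : Action ℐ M)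
    (a : A') : H.restrict β (FibreProd.inl _ _ a) =
      FibreProd.inl _ _ (Ideal.Quotient.mkₐ k H.arrows a) := by
  simp [ClosedSubgroupoid.restrict]

@[simp] theorem ClosedSubgroupoid.restrict_inr_apply (H : ClosedSubgroupoid ℐ) (β : Action ℐ M)
    (m : M) : H.restrict β (FibreProd.inr _ _ m) = FibreProd.inr _ _ (H.j β m) := by
  simp [ClosedSubgroupoid.restrict]

theorem j_comp_moment (α : Action 𝒢 M) (β : Action ℐ M) (H : ClosedSubgroupoid ℐ) :
    (H.j β).comp α.moment = momentFibre α β H :=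
  rfl

variable {α : Action 𝒢 M} {β : Action ℐ M} (h : Commuting α β) (H : ClosedSubgroupoid ℐ)

include h in
theorem mapRight_j_coact_eq_zero (m : M) (hm : m ∈ H.fibreIdeal β) :
    ((FibreProd.mapRight 𝒢.src (H.j β) (j_comp_moment α β H)).comp
      α.coact) m = 0 := by
  suffices H.fibreIdeal β ≤
      RingHom.ker ((FibreProd.mapRight 𝒢.src (H.j β) (j_comp_moment α β H)).comp α.coact) from this hm
  refine Ideal.map_le_iff_le_comap.2 fun r hr => ?_
  have h₁ : α.coact (β.moment r) = FibreProd.inr 𝒢.src α.moment (β.moment r) :=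
    DFunLike.congr_fun h.moment_right_invariant r
  rw [Ideal.mem_comap, RingHom.mem_ker, AlgHom.comp_apply, h₁, FibreProd.mapRight_inr_apply,
    H.j_moment β hr, map_zero]

/-- The coaction of `𝒢` on `ν⁻¹(S)`. -/
def coactFibre : H.Fibre β →ₐ[k] FibreProd 𝒢.src (momentFibre α β H) :=
  Ideal.Quotient.liftₐ (H.fibreIdeal β) _ (mapRight_j_coact_eq_zero h H)

theorem coactFibre_comp_j : (coactFibre h H).comp (H.j β) =
    (FibreProd.mapRight 𝒢.src (H.j β) (j_comp_moment α β H)).comp α.coact :=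
  AlgHom.ext fun _ => rfl

/-- The action of `𝒢` on `ν⁻¹(S)`. -/
def fibreAction : Action 𝒢 (H.Fibre β) :=
  α.ofSurjective (H.j β) (H.j_surjective β) (coactFibre h H) (coactFibre_comp_j h H)

theorem residualIncl_injective : Function.Injective (residualIncl h H) :=
  FibreProd.mapRight_injective _ 𝒢.smooth_src.flat _ _ Subtype.val_injective

/-- The moment map of `𝒢` on `ℋ ×[S] ν⁻¹(S)`, with `𝒢` acting on the second factor. -/
def momentArrows (α : Action 𝒢 M) (β : Action ℐ M) (H : ClosedSubgroupoid ℐ) :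
    R →ₐ[k] FibreProd H.srcH (H.momentH β) :=
  (FibreProd.inr _ _).comp (momentFibre α β H)

theorem inr_comp_momentFibre (α : Action 𝒢 M) (β : Action ℐ M) (H : ClosedSubgroupoid ℐ) :
    (FibreProd.inr H.srcH (H.momentH β)).comp (momentFibre α β H) = momentArrows α β H :=
  rfl

theorem inr_j_comp_moment (α : Action 𝒢 M) (β : Action ℐ M) (H : ClosedSubgroupoid ℐ) :
    ((FibreProd.inr H.srcH (H.momentH β)).comp (H.j β)).comp α.moment = momentArrows α β H :=
  rfl

include h in
theorem coactH_comp_momentFibre :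
    (H.coactH β).comp (momentFibre α β H) = momentArrows α β H :=
  AlgHom.ext fun r => momentFibre_mem h H r

theorem coactFibre_momentH : (coactFibre h H).comp (H.momentH β) =
    (FibreProd.inr 𝒢.src (momentFibre α β H)).comp (H.momentH β) := by
  rw [← AlgHom.cancel_right (Ideal.Quotient.mkₐ_surjective k H.objects)]
  ext r
  have h₁ : α.coact (β.moment r) = FibreProd.inr 𝒢.src α.moment (β.moment r) :=
    DFunLike.congr_fun h.moment_right_invariant r
  change (FibreProd.mapRight 𝒢.src (H.j β) (j_comp_moment α β H)) (α.coact (β.moment r)) = _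
  rw [h₁, FibreProd.mapRight_inr_apply]
  rfl

/-- The exchange `k[ℋ] ⊗ (A ⊗ k[ν⁻¹(S)]) → A ⊗ (k[ℋ] ⊗ k[ν⁻¹(S)])`. -/
def swapFibre (α : Action 𝒢 M) (β : Action ℐ M) (H : ClosedSubgroupoid ℐ) :
    FibreProd H.srcH ((FibreProd.inr 𝒢.src (momentFibre α β H)).comp (H.momentH β)) →ₐ[k]
      FibreProd 𝒢.src (momentArrows α β H) :=
  FibreProd.lift ((FibreProd.inr _ _).comp (FibreProd.inl _ _))
    (FibreProd.lift (FibreProd.inl _ _) ((FibreProd.inr _ _).comp (FibreProd.inr _ _)) (by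
      rw [FibreProd.inl_comp]; rfl)) (by
    ext r
    simp [FibreProd.inl_comp_apply])

/-- The two ways to let `ℋ` and then `𝒢` act on `ν⁻¹(S)` agree. -/
theorem mapRight_coactH_comp_coactFibre :
    (FibreProd.mapRight 𝒢.src (H.coactH β) (coactH_comp_momentFibre h H)).comp (coactFibre h H) =
    ((swapFibre α β H).comp (FibreProd.mapRight H.srcH (coactFibre h H)
      (coactFibre_momentH h H))).comp (H.coactH β) := by
  -- both sides are obtained from the identity `h.comm` by restriction along `q`
  let q : FibreProd ℐ.src ((FibreProd.inr 𝒢.src α.moment).comp β.moment) →ₐ[k]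
      FibreProd 𝒢.src (momentArrows α β H) :=
    FibreProd.lift
      ((FibreProd.inr _ _).comp ((FibreProd.inl _ _).comp (Ideal.Quotient.mkₐ k H.arrows)))
      (FibreProd.mapRight 𝒢.src ((FibreProd.inr H.srcH (H.momentH β)).comp (H.j β))
        (inr_j_comp_moment α β H)) (by
        ext r
        have := DFunLike.congr_fun (H.restrict_compat β) r
        simpa using congrArg (FibreProd.inr 𝒢.src (momentArrows α β H)) this)
  rw [← AlgHom.cancel_right (H.j_surjective β), AlgHom.comp_assoc, AlgHom.comp_assoc,
    coactFibre_comp_j, H.coactH_comp_j, ← AlgHom.comp_assoc, ← AlgHom.comp_assoc]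
  have e₁ : (FibreProd.mapRight 𝒢.src (H.coactH β) (coactH_comp_momentFibre h H)).comp
      (FibreProd.mapRight 𝒢.src (H.j β) (j_comp_moment α β H)) =
      (q.comp (swap α β)).comp (FibreProd.mapRight 𝒢.src β.coact h.moment_left_invariant) := by
    have e₀ : (q.comp (swap α β)).comp (FibreProd.inr _ _) =
        (FibreProd.inr _ _).comp (H.restrict β) := by
      apply FibreProd.hom_ext <;> ext <;> simp [q, swap]
    apply FibreProd.hom_ext
    · ext; simp [q, swap]
    · ext m
      have := DFunLike.congr_fun e₀ (β.coact m)
      have h' := DFunLike.congr_fun (H.coactH_comp_j β) m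
      simp only [AlgHom.comp_apply] at this h'
      simp [this, h']
  have e₂ : ((swapFibre α β H).comp (FibreProd.mapRight H.srcH (coactFibre h H)
      (coactFibre_momentH h H))).comp (H.restrict β) =
      q.comp (FibreProd.mapRight ℐ.src α.coact h.moment_right_invariant) := by
    have e₀ : ((swapFibre α β H).comp (FibreProd.inr _ _)).comp
        (FibreProd.mapRight 𝒢.src (H.j β) (j_comp_moment α β H)) = q.comp (FibreProd.inr _ _) := by
      apply FibreProd.hom_ext <;> ext <;> simp [q, swapFibre]
    apply FibreProd.hom_ext
    · ext; simp [q, swapFibre]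
    · ext m
      have := DFunLike.congr_fun e₀ (α.coact m)
      have h' := DFunLike.congr_fun (coactFibre_comp_j h H) m
      simp only [AlgHom.comp_apply] at this h'
      simp [this, h']
  rw [e₁, e₂, AlgHom.comp_assoc, AlgHom.comp_assoc, AlgHom.comp_assoc, h.comm]

theorem val_comp_momentResidual :
    (H.invariants β).val.comp (momentResidual h H) = momentFibre α β H :=
  rfl

/-- The coaction on `ν⁻¹(S)` maps invariants to invariants, since invariants form an equalizer and
`𝒢` is flat over the base. -/
theorem coactFibre_mem_range {b : H.Fibre β} (hb : b ∈ H.invariants β) :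
    coactFibre h H b ∈ (residualIncl h H).range := by
  refine FibreProd.mem_range_mapRight (τ' := momentFibre α β H) 𝒢.src 𝒢.smooth_src.flat
    (H.invariants β).val (val_comp_momentResidual h H) (H.coactH β) (FibreProd.inr _ _)
    (coactH_comp_momentFibre h H) (inr_comp_momentFibre α β H) (fun d => ?_) ?_
  · rw [Subalgebra.range_val]
    rfl
  · have h₁ := DFunLike.congr_fun (mapRight_coactH_comp_coactFibre h H) b
    have h₂ : (swapFibre α β H).comp (FibreProd.inr _ _) =
        FibreProd.mapRight 𝒢.src (FibreProd.inr _ _) (inr_comp_momentFibre α β H) := by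
      apply FibreProd.hom_ext <;> ext <;> simp [swapFibre]
    simp only [AlgHom.comp_apply] at h₁
    rw [h₁, (H.mem_invariants β).1 hb, FibreProd.mapRight_inr_apply]
    exact DFunLike.congr_fun h₂ _

/-- The coaction on the invariants. -/
def coactResidual : H.invariants β →ₐ[k] FibreProd 𝒢.src (momentResidual h H) :=
  (AlgEquiv.ofInjective (residualIncl h H) (residualIncl_injective h H)).symm.toAlgHom.comp
    (((coactFibre h H).comp (H.invariants β).val).codRestrict _ fun b =>
      coactFibre_mem_range h H b.2)

theorem residualIncl_comp_coactResidual : (residualIncl h H).comp (coactResidual h H) =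
    (coactFibre h H).comp (H.invariants β).val := by
  ext b
  exact congrArg Subtype.val (AlgEquiv.apply_symm_apply
    (AlgEquiv.ofInjective (residualIncl h H) (residualIncl_injective h H)) _)

/-- The action of `𝒢` on the reduced space. -/
def residualAction : Action 𝒢 (H.invariants β) :=
  (fibreAction h H).ofInjective (H.invariants β).val Subtype.val_injective (momentResidual h H)
    (val_comp_momentResidual h H) (coactResidual h H) (residualIncl_comp_coactResidual h H)

end Residual

/-! ### Skew biderivations and products -/

section Biderivation

variable {k : Type*} [CommRing k] {A B C : Type*} [CommRing A] [Algebra k A] [CommRing B]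
  [Algebra k B] [CommRing C] [Algebra k C]

/-- A bracket is skew-symmetric and a derivation in each argument; these are the properties of a
Poisson bracket which pass to products and do not involve the Jacobi identity. -/
structure IsSkewBiderivation (b : A →ₗ[k] A →ₗ[k] A) : Prop where
  skew : ∀ f g, b f g = -b g f
  leibniz : ∀ f g h, b f (g * h) = b f g * h + g * b f h

namespace IsSkewBiderivation

variable {b : A →ₗ[k] A →ₗ[k] A} (hb : IsSkewBiderivation b)

include hb

theorem leibniz_left (f g h : A) : b (f * g) h = b f h * g + f * b g h := by
  rw [hb.skew, hb.leibniz, hb.skew h f, hb.skew h g]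
  ring

theorem one_right (f : A) : b f 1 = 0 := by
  have := hb.leibniz f 1 1
  simpa using this

theorem one_left (f : A) : b 1 f = 0 := by
  rw [hb.skew, hb.one_right, neg_zero]

protected theorem neg : IsSkewBiderivation (-b) where
  skew f g := by simp [hb.skew f g]
  leibniz f g h := by simp [hb.leibniz]; ring

end IsSkewBiderivation

theorem IsPoissonBracket.isSkewBiderivation {b : A →ₗ[k] A →ₗ[k] A} (hb : IsPoissonBracket b) :
    IsSkewBiderivation b where
  skew f g := by
    have := hb.self_eq_zero (f + g)
    simp only [map_add, LinearMap.add_apply, hb.self_eq_zero, zero_add, add_zero] at this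
    exact eq_neg_of_add_eq_zero_right this
  leibniz := hb.leibniz

theorem SymplecticForm.form_skew (ω : SymplecticForm k A) (D E : Derivation k A A) :
    ω.form D E = -ω.form E D :=
  (LinearMap.IsAlt.neg ω.alternating E D).symm

theorem SymplecticForm.bracket_eq_ham (ω : SymplecticForm k A) (f g : A) :
    ω.bracket f g = ω.ham g f :=
  rfl

theorem SymplecticForm.isSkewBiderivation_bracket (ω : SymplecticForm k A) :
    IsSkewBiderivation ω.bracket := by
  have skew : ∀ f g, ω.bracket f g = -ω.bracket g f := fun f g => by
    rw [ω.bracket_apply, ω.bracket_apply, ω.form_skew]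
  refine ⟨skew, fun f g h => ?_⟩
  rw [skew f, skew f g, skew f h, ω.bracket_eq_ham, ω.bracket_eq_ham, ω.bracket_eq_ham,
    Derivation.leibniz, smul_eq_mul, smul_eq_mul]
  ring

@[simp] theorem prodBracket_tmul (a : A →ₗ[k] A →ₗ[k] A) (b : B →ₗ[k] B →ₗ[k] B) (f f' : A)
    (g g' : B) : prodBracket a b (f ⊗ₜ g) (f' ⊗ₜ g') =
      a f f' ⊗ₜ (g * g') + (f * f') ⊗ₜ b g g' := by
  simp [prodBracket]

theorem IsSkewBiderivation.prodBracket {a : A →ₗ[k] A →ₗ[k] A} {b : B →ₗ[k] B →ₗ[k] B}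
    (ha : IsSkewBiderivation a) (hb : IsSkewBiderivation b) :
    IsSkewBiderivation (prodBracket a b) where
  skew x y := by
    induction x using TensorProduct.induction_on with
    | zero => simp
    | add x x' hx hx' => rw [map_add, map_add, LinearMap.add_apply, hx, hx', neg_add]
    | tmul f g =>
      induction y using TensorProduct.induction_on with
      | zero => simp
      | add y y' hy hy' => rw [map_add, map_add, LinearMap.add_apply, hy, hy', neg_add]
      | tmul f' g' =>
        rw [prodBracket_tmul, prodBracket_tmul, ha.skew f f', hb.skew g g', mul_comm g g',
          mul_comm f f', TensorProduct.neg_tmul, TensorProduct.tmul_neg, neg_add]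
  leibniz x y z := by
    induction x using TensorProduct.induction_on with
    | zero => simp
    | add x x' hx hx' =>
      simp only [map_add, LinearMap.add_apply, hx, hx']
      ring
    | tmul f g =>
      induction y using TensorProduct.induction_on with
      | zero => simp
      | add y y' hy hy' =>
        simp only [map_add, add_mul, hy, hy']
        ring
      | tmul f₁ g₁ =>
        induction z using TensorProduct.induction_on with
        | zero => simp
        | add z z' hz hz' =>
          simp only [map_add, mul_add, hz, hz']
          ring
        | tmul f₂ g₂ =>
          simp only [Algebra.TensorProduct.tmul_mul_tmul, prodBracket_tmul, ha.leibniz, hb.leibniz,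
            TensorProduct.add_tmul, TensorProduct.tmul_add, add_mul, mul_add]
          rw [show g * (g₁ * g₂) = g * g₁ * g₂ by ring,
            show f * (f₁ * f₂) = f * f₁ * f₂ by ring, show g₁ * (g * g₂) = g * g₁ * g₂ by ring,
            show f₁ * (f * f₂) = f * f₁ * f₂ by ring]
          abel

/-- Products of Poisson morphisms are Poisson. -/
theorem prodBracket_map {A' B' : Type*} [CommRing A'] [Algebra k A'] [CommRing B'] [Algebra k B']
    {a : A →ₗ[k] A →ₗ[k] A} {b : B →ₗ[k] B →ₗ[k] B} {a' : A' →ₗ[k] A' →ₗ[k] A'}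
    {b' : B' →ₗ[k] B' →ₗ[k] B'} (f : A →ₐ[k] A') (g : B →ₐ[k] B')
    (hf : ∀ x y, f (a x y) = a' (f x) (f y)) (hg : ∀ x y, g (b x y) = b' (g x) (g y))
    (x y : A ⊗[k] B) :
    Algebra.TensorProduct.map f g (prodBracket a b x y) =
      prodBracket a' b' (Algebra.TensorProduct.map f g x) (Algebra.TensorProduct.map f g y) := by
  induction x using TensorProduct.induction_on with
  | zero => simp
  | add x x' hx hx' => simp only [map_add, LinearMap.add_apply, hx, hx']
  | tmul x₁ x₂ =>
    induction y using TensorProduct.induction_on with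
    | zero => simp
    | add y y' hy hy' => simp only [map_add, hy, hy']
    | tmul y₁ y₂ => simp [hf, hg]

/-- If the graph of a morphism `f : E → B ⊗[R] C` is coisotropic, then `f` is computed on brackets
by the product bracket of arbitrary representatives in `B ⊗[k] C`. -/
theorem map_bracket_of_isCoisotropic_graphIdeal {R E : Type*} [CommRing R] [Algebra k R]
    [CommRing E] [Algebra k E] {σ : R →ₐ[k] B} {τ : R →ₐ[k] C} {f : E →ₐ[k] FibreProd σ τ}
    {b : B →ₗ[k] B →ₗ[k] B} {c : C →ₗ[k] C →ₗ[k] C} {e : E →ₗ[k] E →ₗ[k] E}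
    (hb : IsSkewBiderivation b) (hc : IsSkewBiderivation c) (he : IsSkewBiderivation e)
    (H : IsCoisotropic (prodBracket (prodBracket b c) (-e)) (FibreProd.graphIdeal f))
    {x y : E} {z w : B ⊗[k] C} (hz : FibreProd.ofTensor σ τ z = f x)
    (hw : FibreProd.ofTensor σ τ w = f y) :
    f (e x y) = FibreProd.ofTensor σ τ (prodBracket b c z w) := by
  have mem : ∀ {x : E} {z : B ⊗[k] C}, FibreProd.ofTensor σ τ z = f x →
      z ⊗ₜ[k] (1 : E) - (1 : B ⊗[k] C) ⊗ₜ[k] x ∈ FibreProd.graphIdeal f := fun {x z} h => by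
    change Algebra.TensorProduct.productMap (FibreProd.ofTensor σ τ) f _ = 0
    simp [h]
  have h := H _ (mem hz) _ (mem hw)
  have hbc := hb.prodBracket hc
  change Algebra.TensorProduct.productMap (FibreProd.ofTensor σ τ) f _ = 0 at h
  simp only [map_sub, LinearMap.sub_apply, prodBracket_tmul, hbc.one_left, hbc.one_right,
    he.neg.one_left, he.neg.one_right] at h
  simp only [LinearMap.neg_apply, mul_one, TensorProduct.tmul_zero, add_zero, one_mul, zero_tmul,
    sub_zero, zero_add, Algebra.TensorProduct.productMap_apply_tmul, map_one, map_neg,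
    sub_neg_eq_add, map_zero] at h
  exact (sub_eq_zero.1 h).symm

end Biderivation

/-! ### Hamiltonian vector fields generate all derivations -/

section Generation

variable {k : Type*} [CommRing k] {A B : Type*} [CommRing A] [Algebra k A] [CommRing B]
  [Algebra k B]

/-- A linear map `v` is a derivation along the algebra morphism `e`, i.e. a tangent vector at the
`B`-valued point `e`. -/
def IsDerivationAlong (e : A →ₐ[k] B) (v : A →ₗ[k] B) : Prop :=
  ∀ a b, v (a * b) = e a * v b + e b * v a

theorem IsDerivationAlong.map_one {e : A →ₐ[k] B} {v : A →ₗ[k] B} (hv : IsDerivationAlong e v) :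
    v 1 = 0 := by
  have := hv 1 1
  simpa using this

theorem IsDerivationAlong.comp_derivation (e : A →ₐ[k] B) (D : Derivation k A A) :
    IsDerivationAlong e (e.toLinearMap ∘ₗ D.toLinearMap) := fun a b => by
  simp

/-- The `B[ε]`-valued point `a ↦ e a + v a ε`. -/
def dualPoint (e : A →ₐ[k] B) (v : A →ₗ[k] B) (hv : IsDerivationAlong e v) :
    A →ₐ[k] TrivSqZeroExt B B :=
  AlgHom.ofLinearMap
    ((TrivSqZeroExt.inlAlgHom k B B).toLinearMap ∘ₗ e.toLinearMap +
      ((TrivSqZeroExt.inrHom B B).restrictScalars k) ∘ₗ v)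
    (by ext <;> simp [hv.map_one])
    (fun a b => by ext <;> simp [hv a b, mul_comm])

@[simp] theorem fst_dualPoint (e : A →ₐ[k] B) (v : A →ₗ[k] B) (hv : IsDerivationAlong e v)
    (a : A) : (dualPoint e v hv a).fst = e a := by
  simp [dualPoint]

@[simp] theorem snd_dualPoint (e : A →ₐ[k] B) (v : A →ₗ[k] B) (hv : IsDerivationAlong e v)
    (a : A) : (dualPoint e v hv a).snd = v a := by
  simp [dualPoint]

/-- The tangent vector of a `B[ε]`-valued point. -/
theorem isDerivationAlong_snd (u : A →ₐ[k] TrivSqZeroExt B B) :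
    IsDerivationAlong ((TrivSqZeroExt.fstHom k B B).comp u)
      (((TrivSqZeroExt.sndHom B B).restrictScalars k) ∘ₗ u.toLinearMap) := fun a b => by
  simp [mul_comm]

variable (ω : SymplecticForm k A)

/-- As `Ω[A⁄k]` is reflexive, nondegeneracy of `ω` makes every vector field a combination of
Hamiltonian ones. -/
theorem SymplecticForm.mem_span_ham [Algebra.Smooth k A] (D : Derivation k A A) :
    D ∈ Submodule.span A (Set.range ω.ham) := by
  have key : ∀ w : Ω[A⁄k], ∃ D ∈ Submodule.span A (Set.range ω.ham),
      ∀ E : Derivation k A A, ω.form D E = E.liftKaehlerDifferential w := fun w => by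
    have hw : w ∈ Submodule.span A (Set.range (KaehlerDifferential.D k A)) := by
      rw [KaehlerDifferential.span_range_derivation]; trivial
    induction hw using Submodule.span_induction with
    | mem x hx =>
      obtain ⟨f, rfl⟩ := hx
      exact ⟨ω.ham f, Submodule.subset_span ⟨f, rfl⟩, fun E => by
        rw [ω.form_ham, Derivation.liftKaehlerDifferential_comp_D]⟩
    | zero => exact ⟨0, zero_mem _, fun E => by simp⟩
    | add x y _ _ hx hy =>
      obtain ⟨D, hD, h⟩ := hx
      obtain ⟨D', hD', h'⟩ := hy
      exact ⟨D + D', add_mem hD hD', fun E => by simp [h, h']⟩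
    | smul c x _ hx =>
      obtain ⟨D, hD, h⟩ := hx
      exact ⟨c • D, Submodule.smul_mem _ _ hD, fun E => by simp [h]⟩
  let eqv := KaehlerDifferential.linearMapEquivDerivation k A (M := A)
  obtain ⟨w, hw⟩ := (Module.bijective_dual_eval A Ω[A⁄k]).2
    ((ω.form D).comp eqv.toLinearMap)
  obtain ⟨D', hD', h⟩ := key w
  have : D' = D := by
    apply ω.nondegenerate.1
    ext E
    rw [h]
    have h' := DFunLike.congr_fun hw E.liftKaehlerDifferential
    have h'' : eqv E.liftKaehlerDifferential = E := eqv.apply_symm_apply E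
    simp only [Module.Dual.eval_apply, LinearMap.comp_apply] at h'
    rw [h']
    exact congrArg (ω.form D) h''
  rw [← this]
  exact hD'

/-- Every tangent vector at a point of a smooth symplectic variety is a combination of values of
Hamiltonian vector fields. -/
theorem SymplecticForm.exists_eq_sum_bracket [Algebra.Smooth k A] (e : A →ₐ[k] B)
    (v : A →ₗ[k] B) (hv : IsDerivationAlong e v) :
    ∃ c : A →₀ B, ∀ a, v a = c.sum fun f b => b * e (ω.bracket a f) := by
  let ψ : A → A → B := fun f a => e (ω.bracket a f)
  suffices h : (v : A → B) ∈ Submodule.span B (Set.range ψ) by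
    obtain ⟨c, hc⟩ := Finsupp.mem_span_range_iff_exists_finsupp.1 h
    refine ⟨c, fun a => ?_⟩
    rw [← hc, Finsupp.sum, Finsupp.sum, Finset.sum_apply]
    rfl
  have hD : ∀ D : Derivation k A A, (fun a => e (D a)) ∈ Submodule.span B (Set.range ψ) :=
    fun D => by
      induction ω.mem_span_ham D using Submodule.span_induction with
      | mem x hx =>
        obtain ⟨f, rfl⟩ := hx
        exact Submodule.subset_span ⟨f, rfl⟩
      | zero =>
        rw [show (fun a => e ((0 : Derivation k A A) a)) = 0 by ext; simp]
        exact zero_mem _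
      | add x y _ _ hx hy =>
        rw [show (fun a => e ((x + y) a)) = (fun a => e (x a)) + fun a => e (y a) by ext; simp]
        exact add_mem hx hy
      | smul c x _ hx =>
        rw [show (fun a => e ((c • x) a)) = e c • fun a => e (x a) by ext; simp]
        exact Submodule.smul_mem _ _ hx
  let _ := e.toRingHom.toAlgebra
  have : IsScalarTower k A B := IsScalarTower.of_algebraMap_eq' e.comp_algebraMap.symm
  let v' : Derivation k A B := Derivation.mk' v hv
  -- a dual basis of the projective module of differentials
  obtain ⟨n, p, hp⟩ := Module.Finite.exists_fin' A Ω[A⁄k]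
  obtain ⟨s, hs⟩ := Module.projective_lifting_property p LinearMap.id hp
  have hdual : ∀ a, v a = ∑ i, v'.liftKaehlerDifferential (p (Pi.single i 1)) *
      e (s (KaehlerDifferential.D k A a) i) := fun a => by
    have h₁ : p (s (KaehlerDifferential.D k A a)) = KaehlerDifferential.D k A a :=
      DFunLike.congr_fun hs _
    have h₂ : v'.liftKaehlerDifferential (KaehlerDifferential.D k A a) = v a :=
      v'.liftKaehlerDifferential_comp_D a
    rw [← h₂, ← h₁]
    conv_lhs => rw [pi_eq_sum_univ' (s (KaehlerDifferential.D k A a)), map_sum, map_sum]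
    refine Finset.sum_congr rfl fun i _ => ?_
    rw [map_smul, map_smul, h₁, Algebra.smul_def, mul_comm]
    congr 2
  have : (v : A → B) = ∑ i, v'.liftKaehlerDifferential (p (Pi.single i 1)) •
      fun a => e (s (KaehlerDifferential.D k A a) i) := by
    ext a
    rw [hdual, Finset.sum_apply]
    rfl
  rw [this]
  exact sum_mem fun i _ => Submodule.smul_mem _ _
    (hD (((LinearMap.proj i).comp s).compDer (KaehlerDifferential.D k A)))

end Generation

/-! ### Calculus with points of a groupoid -/

namespace LieGroupoid

variable {k : Type*} [CommRing k] {R : Type u₁} {A : Type u₂} [CommRing R]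
    [CommRing A] [Algebra k R] [Algebra k A] (𝒢 : LieGroupoid k R A)
    {D : Type u₃} [CommRing D] [Algebra k D]

theorem prod_assoc (g h l : A →ₐ[k] D) (w₁ : g.comp 𝒢.src = h.comp 𝒢.tgt)
    (w₂ : h.comp 𝒢.src = l.comp 𝒢.tgt) :
    𝒢.prod (𝒢.prod g h w₁) l ((𝒢.prod_src g h w₁).trans w₂) =
      𝒢.prod g (𝒢.prod h l w₂) (w₁.trans (𝒢.prod_tgt h l w₂).symm) := by
  let u : 𝒢.Triples →ₐ[k] D := FibreProd.lift g (FibreProd.lift h l w₂) (by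
    rw [w₁, ← AlgHom.comp_assoc, FibreProd.lift_inl])
  have h₁ : u.comp 𝒢.triple₁ = g := by ext; simp [u, PreGroupoid.triple₁]
  have h₂ : u.comp 𝒢.triple₂ = h := by ext; simp [u, PreGroupoid.triple₂]
  have h₃ : u.comp 𝒢.triple₃ = l := by ext; simp [u, PreGroupoid.triple₃]
  have h₁₂ := (𝒢.comp_prod u _ _ 𝒢.triple₁₂).trans (𝒢.prod_congr h₁ h₂ _)
  have h₂₃ := (𝒢.comp_prod u _ _ 𝒢.triple₂₃).trans (𝒢.prod_congr h₂ h₃ _)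
  exact ((𝒢.prod_congr h₁₂.symm h₃.symm _).trans (𝒢.comp_prod u _ _ _).symm).trans
    ((congrArg u.comp 𝒢.mul_assoc).trans
      ((𝒢.comp_prod u _ _ _).trans (𝒢.prod_congr h₁ h₂₃ _)))

theorem prod_inv (g : A →ₐ[k] D) :
    𝒢.prod g (g.comp 𝒢.inv) (by rw [AlgHom.comp_assoc, 𝒢.inv_tgt]) =
      g.comp (𝒢.tgt.comp 𝒢.one) := by
  rw [← 𝒢.mul_inv, 𝒢.comp_prod]
  rfl

theorem inv_prod (g : A →ₐ[k] D) :
    𝒢.prod (g.comp 𝒢.inv) g (by rw [AlgHom.comp_assoc, 𝒢.inv_src]) =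
      g.comp (𝒢.src.comp 𝒢.one) := by
  rw [← 𝒢.inv_mul, 𝒢.comp_prod]
  rfl

theorem one_prod (g : A →ₐ[k] D) :
    𝒢.prod (g.comp (𝒢.tgt.comp 𝒢.one)) g
      (by rw [AlgHom.comp_assoc, AlgHom.comp_assoc, 𝒢.one_src]; rfl) = g := by
  have := congrArg g.comp 𝒢.one_mul
  rw [𝒢.comp_prod] at this
  exact this

@[simp] theorem one_src_apply (r : R) : 𝒢.one (𝒢.src r) = r :=
  DFunLike.congr_fun 𝒢.one_src r

@[simp] theorem one_tgt_apply (r : R) : 𝒢.one (𝒢.tgt r) = r :=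
  DFunLike.congr_fun 𝒢.one_tgt r

theorem mul_src_apply (r : R) : 𝒢.mul (𝒢.src r) = FibreProd.inr _ _ (𝒢.src r) :=
  DFunLike.congr_fun 𝒢.mul_src r

theorem mul_tgt_apply (r : R) : 𝒢.mul (𝒢.tgt r) = FibreProd.inl _ _ (𝒢.tgt r) :=
  DFunLike.congr_fun 𝒢.mul_tgt r

/-- Right multiplication by units is trivial, for representatives in `A ⊗[k] A`. -/
theorem productMap_id_one {z : A ⊗[k] A} {a : A} (h : FibreProd.ofTensor 𝒢.src 𝒢.tgt z = 𝒢.mul a) :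
    Algebra.TensorProduct.productMap (AlgHom.id k A) (𝒢.src.comp 𝒢.one) z = a := by
  have w : (AlgHom.id k A).comp 𝒢.src = (𝒢.src.comp 𝒢.one).comp 𝒢.tgt := by
    rw [AlgHom.comp_assoc, 𝒢.one_tgt]; rfl
  rw [← FibreProd.lift_ofTensor _ _ w, h]
  exact DFunLike.congr_fun 𝒢.mul_one a

/-- Left multiplication by units is trivial, for representatives in `A ⊗[k] A`. -/
theorem productMap_one_id {z : A ⊗[k] A} {a : A} (h : FibreProd.ofTensor 𝒢.src 𝒢.tgt z = 𝒢.mul a) :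
    Algebra.TensorProduct.productMap (𝒢.tgt.comp 𝒢.one) (AlgHom.id k A) z = a := by
  have w : (𝒢.tgt.comp 𝒢.one).comp 𝒢.src = (AlgHom.id k A).comp 𝒢.tgt := by
    rw [AlgHom.comp_assoc, 𝒢.one_src]; rfl
  rw [← FibreProd.lift_ofTensor _ _ w, h]
  exact DFunLike.congr_fun 𝒢.one_mul a

theorem productMap_one_one {z : A ⊗[k] A} {a : A} (h : FibreProd.ofTensor 𝒢.src 𝒢.tgt z = 𝒢.mul a) :
    Algebra.TensorProduct.productMap 𝒢.one 𝒢.one z = 𝒢.one a := by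
  have : Algebra.TensorProduct.productMap 𝒢.one 𝒢.one = 𝒢.one.comp
      (Algebra.TensorProduct.productMap (AlgHom.id k A) (𝒢.src.comp 𝒢.one)) :=
    Algebra.TensorProduct.ext' fun a b => by simp
  rw [this, AlgHom.comp_apply, 𝒢.productMap_id_one h]

theorem inl_injective : Function.Injective (FibreProd.inl 𝒢.src 𝒢.tgt) :=
  Function.LeftInverse.injective
    (g := FibreProd.lift (AlgHom.id k A) (𝒢.src.comp 𝒢.one)
      (by rw [AlgHom.comp_assoc, 𝒢.one_tgt]; rfl)) fun a => by simp

end LieGroupoid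

/-! ### Symplectic groupoids -/

theorem prodBracket_left {k A B : Type*} [CommRing k] [CommRing A] [Algebra k A] [CommRing B]
    [Algebra k B] {a : A →ₗ[k] A →ₗ[k] A} {b : B →ₗ[k] B →ₗ[k] B} (hb : IsSkewBiderivation b)
    (x y : A) (z : B) : prodBracket a b (x ⊗ₜ 1) (y ⊗ₜ z) = a x y ⊗ₜ z := by
  simp [hb.one_left]

theorem prodBracket_right {k A B : Type*} [CommRing k] [CommRing A] [Algebra k A] [CommRing B]
    [Algebra k B] {a : A →ₗ[k] A →ₗ[k] A} {b : B →ₗ[k] B →ₗ[k] B} (ha : IsSkewBiderivation a)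
    (x : B) (y : A) (z : B) : prodBracket a b (y ⊗ₜ z) (1 ⊗ₜ x) = y ⊗ₜ b z x := by
  simp [ha.one_right]

/-- A bracket vanishes at a point `ε` when one argument vanishes there to second order. -/
theorem IsSkewBiderivation.map_eq_zero_of_mem_sq {k A B : Type*} [CommRing k] [CommRing A]
    [Algebra k A] [CommRing B] [Algebra k B] {b : A →ₗ[k] A →ₗ[k] A} (hb : IsSkewBiderivation b)
    (ε : A →ₐ[k] B) {x : A} (hx : x ∈ RingHom.ker ε * RingHom.ker ε) (y : A) :
    ε (b x y) = 0 := by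
  induction hx using Submodule.mul_induction_on' with
  | mem_mul_mem u hu v hv =>
    rw [hb.leibniz_left, map_add, map_mul, map_mul, RingHom.mem_ker.1 hu, RingHom.mem_ker.1 hv,
      mul_zero, zero_mul, zero_add]
  | add u _ v _ hu hv => rw [map_add, LinearMap.add_apply, map_add, hu, hv, zero_add]

namespace IsSymplecticGroupoid

variable {k : Type*} [CommRing k] {R : Type u₁} {A : Type u₂} [CommRing R]
    [CommRing A] [Algebra k R] [Algebra k A] {𝒢 : LieGroupoid k R A} {ω : SymplecticForm k A}
    (hω : IsSymplecticGroupoid 𝒢 ω)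

include hω

theorem mul_bracket {x y : A} {z w : A ⊗[k] A} (hz : FibreProd.ofTensor 𝒢.src 𝒢.tgt z = 𝒢.mul x)
    (hw : FibreProd.ofTensor 𝒢.src 𝒢.tgt w = 𝒢.mul y) :
    𝒢.mul (ω.bracket x y) = FibreProd.ofTensor 𝒢.src 𝒢.tgt (prodBracket ω.bracket ω.bracket z w) :=
  map_bracket_of_isCoisotropic_graphIdeal ω.isSkewBiderivation_bracket
    ω.isSkewBiderivation_bracket ω.isSkewBiderivation_bracket hω hz hw

theorem bracket_src_tgt (r q : R) : ω.bracket (𝒢.src r) (𝒢.tgt q) = 0 := by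
  -- `s^*r ⊗ 1 - 1 ⊗ t^*r` represents `0`, and `t^*q ⊗ 1` represents `t^*q`
  have h := hω.mul_bracket (x := 0) (y := 𝒢.tgt q)
    (z := 𝒢.src r ⊗ₜ 1 - 1 ⊗ₜ 𝒢.tgt r) (w := 𝒢.tgt q ⊗ₜ 1)
    (by simp [FibreProd.inl_comp_apply]) (by simp [𝒢.mul_tgt_apply])
  have hb := ω.isSkewBiderivation_bracket
  simp only [map_zero, LinearMap.zero_apply, map_sub, LinearMap.sub_apply, prodBracket_tmul,
    hb.one_right, hb.one_left] at h
  apply 𝒢.inl_injective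
  simpa using h.symm

theorem bracket_tgt_src (r q : R) : ω.bracket (𝒢.tgt r) (𝒢.src q) = 0 := by
  rw [ω.isSkewBiderivation_bracket.skew, hω.bracket_src_tgt, neg_zero]

/-- The units form a coisotropic submanifold. -/
theorem one_bracket_eq_zero {a b : A} (ha : 𝒢.one a = 0) (hb : 𝒢.one b = 0) :
    𝒢.one (ω.bracket a b) = 0 := by
  -- for `a` vanishing on the units, `m^*a = a ⊗ 1 + 1 ⊗ a` to second order at pairs of units
  let ε : A ⊗[k] A →ₐ[k] R := Algebra.TensorProduct.productMap 𝒢.one 𝒢.one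
  have key : ∀ a, 𝒢.one a = 0 → ∃ y ∈ RingHom.ker ε * RingHom.ker ε,
      FibreProd.ofTensor 𝒢.src 𝒢.tgt (a ⊗ₜ 1 + 1 ⊗ₜ a + y) = 𝒢.mul a := by
    intro a ha
    obtain ⟨z, hz⟩ := FibreProd.ofTensor_surjective 𝒢.src 𝒢.tgt (𝒢.mul a)
    let p : A →ₗ[k] A := LinearMap.id - (𝒢.src.comp 𝒢.one).toLinearMap
    let q : A →ₗ[k] A := LinearMap.id - (𝒢.tgt.comp 𝒢.one).toLinearMap
    refine ⟨TensorProduct.map p q z, ?_, ?_⟩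
    · clear hz
      induction z using TensorProduct.induction_on with
      | zero => rw [map_zero]; exact zero_mem _
      | add x y hx hy => rw [map_add]; exact add_mem hx hy
      | tmul x y =>
        rw [TensorProduct.map_tmul, ← mul_one (p x), ← one_mul (q y),
          ← Algebra.TensorProduct.tmul_mul_tmul]
        refine Ideal.mul_mem_mul (RingHom.mem_ker.2 ?_) (RingHom.mem_ker.2 ?_) <;> simp [ε, p, q]
    · have h : ∀ z : A ⊗[k] A, FibreProd.ofTensor 𝒢.src 𝒢.tgt (TensorProduct.map p q z) =
          FibreProd.ofTensor 𝒢.src 𝒢.tgt z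
          - FibreProd.inl _ _ (Algebra.TensorProduct.productMap (AlgHom.id k A)
            (𝒢.src.comp 𝒢.one) z)
          - FibreProd.inr _ _ (Algebra.TensorProduct.productMap (𝒢.tgt.comp 𝒢.one)
            (AlgHom.id k A) z)
          + FibreProd.inl _ _ (𝒢.src (ε z)) := fun z => by
        induction z using TensorProduct.induction_on with
        | zero => simp
        | add x y hx hy =>
          simp only [map_add, hx, hy]
          ring
        | tmul x y =>
          simp [p, q, ε, FibreProd.inl_comp_apply]
          ring
      rw [map_add, h, 𝒢.productMap_id_one hz, 𝒢.productMap_one_id hz,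
        show ε z = 0 from (𝒢.productMap_one_one hz).trans ha, hz]
      simp
  obtain ⟨y, hy, hy'⟩ := key a ha
  obtain ⟨w, hw, hw'⟩ := key b hb
  have hs := ω.isSkewBiderivation_bracket
  have hp := hs.prodBracket hs
  have h₁ := 𝒢.productMap_one_one (hω.mul_bracket hy' hw').symm
  change ε _ = _ at h₁
  rw [map_add, map_add, hp.skew _ w, map_neg, hp.map_eq_zero_of_mem_sq ε hw, map_add _ _ y,
    LinearMap.add_apply, map_add, hp.map_eq_zero_of_mem_sq ε hy] at h₁
  simpa [hs.one_left, hs.one_right, ε] using h₁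

/-- At the units, `X_a` is the sum of `X_{s^*1^*a}`, tangent to the target fibres, and of a vector
field tangent to the units. -/
theorem one_bracket (a b : A) :
    𝒢.one (ω.bracket a b) =
      𝒢.one (ω.bracket a (𝒢.src (𝒢.one b))) + 𝒢.one (ω.bracket (𝒢.tgt (𝒢.one a)) b) := by
  have h := hω.one_bracket_eq_zero (a := a - 𝒢.tgt (𝒢.one a)) (b := b - 𝒢.src (𝒢.one b))
    (by simp) (by simp)
  simp only [map_sub, LinearMap.sub_apply, hω.bracket_tgt_src, sub_zero] at h
  linear_combination h

theorem one_bracket_src_src (r q : R) :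
    𝒢.one (ω.bracket (𝒢.src r) (𝒢.src q)) = -𝒢.one (ω.bracket (𝒢.tgt r) (𝒢.tgt q)) := by
  have h := hω.one_bracket (𝒢.src r) (𝒢.tgt q)
  rw [hω.bracket_src_tgt, map_zero, 𝒢.one_tgt_apply, 𝒢.one_src_apply] at h
  linear_combination -h

/-- Every vector tangent to the target fibres is a combination of the Hamiltonian vector fields of
functions pulled back along the source: move it to a unit by a left translation, and use the
splitting `one_bracket` there. -/
theorem exists_eq_sum_bracket_src {B : Type u₃} [CommRing B] [Algebra k B] (e : A →ₐ[k] B)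
    (v : A →ₗ[k] B) (hv : IsDerivationAlong e v) (ht : ∀ r, v (𝒢.tgt r) = 0) :
    ∃ c : A →₀ B, ∀ a, v a = c.sum fun f b => b * e (ω.bracket a (𝒢.src (𝒢.one f))) := by
  have := 𝒢.smooth_arrows
  let g : A →ₐ[k] TrivSqZeroExt B B := (TrivSqZeroExt.inlAlgHom k B B).comp e
  let gv := dualPoint e v hv
  have hgv : gv.comp 𝒢.tgt = g.comp 𝒢.tgt := by
    ext r <;> simp [gv, g, ht]
  have w₁ : (g.comp 𝒢.inv).comp 𝒢.src = gv.comp 𝒢.tgt := by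
    rw [hgv, AlgHom.comp_assoc g, 𝒢.inv_src]
  have w₀ : g.comp 𝒢.src = (g.comp 𝒢.inv).comp 𝒢.tgt := by
    rw [AlgHom.comp_assoc g, 𝒢.inv_tgt]
  let u := 𝒢.prod (g.comp 𝒢.inv) gv w₁
  have hu₀ : (TrivSqZeroExt.fstHom k B B).comp u = e.comp (𝒢.src.comp 𝒢.one) := by
    have h₁ : (TrivSqZeroExt.fstHom k B B).comp (g.comp 𝒢.inv) = e.comp 𝒢.inv := by
      ext; simp [g]
    have h₂ : (TrivSqZeroExt.fstHom k B B).comp gv = e := by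
      ext; simp [gv]
    rw [𝒢.comp_prod, 𝒢.prod_congr h₁ h₂, 𝒢.inv_prod]
  have hu : 𝒢.prod g u (w₀.trans (𝒢.prod_tgt _ _ w₁).symm) = gv := by
    rw [← 𝒢.prod_assoc g (g.comp 𝒢.inv) gv w₀ w₁, 𝒢.prod_congr (𝒢.prod_inv g) rfl]
    have : g.comp (𝒢.tgt.comp 𝒢.one) = gv.comp (𝒢.tgt.comp 𝒢.one) := by
      rw [← AlgHom.comp_assoc, ← AlgHom.comp_assoc, hgv]
    rw [𝒢.prod_congr this rfl, 𝒢.one_prod]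
  let v' : A →ₗ[k] B := ((TrivSqZeroExt.sndHom B B).restrictScalars k) ∘ₗ u.toLinearMap
  have hv' : IsDerivationAlong (e.comp (𝒢.src.comp 𝒢.one)) v' := by
    rw [← hu₀]
    exact isDerivationAlong_snd u
  have hv't : ∀ r, v' (𝒢.tgt r) = 0 := fun r => by
    have : u (𝒢.tgt r) = g (𝒢.inv (𝒢.tgt r)) := DFunLike.congr_fun (𝒢.prod_tgt _ _ w₁) r
    simp [v', this, g]
  obtain ⟨c, hc⟩ := ω.exists_eq_sum_bracket _ v' hv'
  refine ⟨c, fun a => ?_⟩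
  have hc' : ∀ a, v' a =
      c.sum fun f b => b * e (𝒢.src (𝒢.one (ω.bracket a (𝒢.src (𝒢.one f))))) := fun a => by
    have h₀ := hc (𝒢.tgt (𝒢.one a))
    rw [hv't] at h₀
    rw [hc, ← add_zero (c.sum fun f b => b * e (𝒢.src (𝒢.one (ω.bracket a (𝒢.src (𝒢.one f)))))),
      h₀, ← Finsupp.sum_add]
    refine Finsupp.sum_congr fun f _ => ?_
    simp only [AlgHom.comp_apply]
    rw [← mul_add, ← map_add, ← map_add, ← hω.one_bracket]
  obtain ⟨z, hz⟩ := FibreProd.ofTensor_surjective 𝒢.src 𝒢.tgt (𝒢.mul a)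
  have h₁ : v a = (Algebra.TensorProduct.productMap g u z).snd := by
    rw [← FibreProd.lift_ofTensor g u (w₀.trans (𝒢.prod_tgt _ _ w₁).symm), hz]
    change _ = (𝒢.prod g u (w₀.trans (𝒢.prod_tgt _ _ w₁).symm) a).snd
    rw [hu]
    simp [gv]
  have hs := ω.isSkewBiderivation_bracket
  have h₂ : ∀ r, ω.bracket a (𝒢.src r) = Algebra.TensorProduct.productMap (AlgHom.id k A)
      (𝒢.src.comp 𝒢.one) (prodBracket ω.bracket ω.bracket z (1 ⊗ₜ 𝒢.src r)) := fun r =>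
    (𝒢.productMap_id_one (hω.mul_bracket hz (by simp [𝒢.mul_src_apply])).symm).symm
  rw [h₁]
  simp only [h₂]
  clear hz h₁ h₂
  induction z using TensorProduct.induction_on with
  | zero => simp
  | add x y hx hy =>
    simp only [map_add, TrivSqZeroExt.snd_add, hx, hy, LinearMap.add_apply, mul_add]
    rw [← Finsupp.sum_add]
  | tmul x y =>
    have h₃ : (Algebra.TensorProduct.productMap g u (x ⊗ₜ y)).snd = e x * v' y := by
      simp [g, v']
    rw [h₃, hc', Finsupp.mul_sum]
    refine Finsupp.sum_congr fun f _ => ?_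
    rw [prodBracket_right hs]
    simp
    ring

end IsSymplecticGroupoid

/-! ### Lifting along formally smooth morphisms -/

section Lifting

variable {k : Type*} [CommRing k] {R A B C : Type*} [CommRing R] [CommRing A] [CommRing B]
  [CommRing C] [Algebra k R] [Algebra k A] [Algebra k B] [Algebra k C]

/-- The infinitesimal lifting property for morphisms of `k`-algebras. -/
theorem exists_lift_of_formallySmooth {σ : R →ₐ[k] A} (hσ : σ.toRingHom.FormallySmooth)
    (p : B →ₐ[k] C) (hp : Function.Surjective p) (hn : IsNilpotent (RingHom.ker p))
    (f : R →ₐ[k] B) (g : A →ₐ[k] C) (h : p.comp f = g.comp σ) :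
    ∃ g' : A →ₐ[k] B, p.comp g' = g ∧ g'.comp σ = f := by
  let _ := σ.toRingHom.toAlgebra
  let _ := f.toRingHom.toAlgebra
  let _ := (p.comp f).toRingHom.toAlgebra
  have : Algebra.FormallySmooth R A := hσ
  let pR : B →ₐ[R] C := { p.toRingHom with commutes' := fun _ => rfl }
  let gR : A →ₐ[R] C := { g.toRingHom with commutes' := fun r => (DFunLike.congr_fun h r).symm }
  let l : A →ₐ[R] B := Algebra.FormallySmooth.liftOfSurjective gR pR hp hn
  have hl : ∀ r, l (σ r) = f r := l.commutes
  refine ⟨{ l.toRingHom with commutes' := fun c => ?_ }, ?_, ?_⟩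
  · have := hl (algebraMap k R c)
    rw [AlgHom.commutes, AlgHom.commutes] at this
    exact this
  · ext a
    exact Algebra.FormallySmooth.liftOfSurjective_apply gR pR hp hn a
  · ext r
    exact hl r

/-- The algebra `B[X]/(X^{n+2})` of jets of order `n + 1`. -/
abbrev Jet (B : Type*) [CommRing B] (n : ℕ) : Type _ :=
  Polynomial B ⧸ Ideal.span {(Polynomial.X : Polynomial B) ^ (n + 2)}

/-- Constant jets. -/
def Jet.const (k B : Type*) [CommRing k] [CommRing B] [Algebra k B] (n : ℕ) :
    B →ₐ[k] Jet B n :=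
  (Ideal.Quotient.mkₐ k _).comp (Polynomial.CAlgHom (R := k))

theorem Jet.aeval_eps (f : Polynomial B) :
    Polynomial.aeval (TrivSqZeroExt.inr 1 : TrivSqZeroExt B B) f =
      TrivSqZeroExt.inl (f.coeff 0) + TrivSqZeroExt.inr (f.coeff 1) := by
  induction f using Polynomial.induction_on' with
  | add p q hp hq =>
    rw [map_add, hp, hq, Polynomial.coeff_add, Polynomial.coeff_add]
    ext <;> simp
  | monomial n a =>
    rw [Polynomial.aeval_monomial]
    match n with
    | 0 => ext <;> simp [TrivSqZeroExt.algebraMap_eq_inl]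
    | 1 => ext <;> simp [TrivSqZeroExt.algebraMap_eq_inl, Polynomial.coeff_monomial]
    | n + 2 =>
      rw [pow_add, pow_two, TrivSqZeroExt.inr_mul_inr]
      ext <;> simp [Polynomial.coeff_monomial]

/-- Truncation of jets to first order, i.e. to `B[ε]`. -/
def Jet.trunc (k B : Type*) [CommRing k] [CommRing B] [Algebra k B] (n : ℕ) :
    Jet B n →ₐ[k] TrivSqZeroExt B B :=
  Ideal.Quotient.liftₐ _ ((Polynomial.aeval (TrivSqZeroExt.inr 1 : TrivSqZeroExt B B)).restrictScalars k)
    (fun a ha => by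
      suffices h : Ideal.span {(Polynomial.X : Polynomial B) ^ (n + 2)} ≤
          RingHom.ker (Polynomial.aeval (TrivSqZeroExt.inr 1 : TrivSqZeroExt B B)) from h ha
      rw [Ideal.span_singleton_le_iff_mem, RingHom.mem_ker, map_pow, Polynomial.aeval_X, pow_add,
        pow_two, TrivSqZeroExt.inr_mul_inr, mul_zero])

theorem Jet.trunc_mk (n : ℕ) (f : Polynomial B) :
    Jet.trunc k B n (Ideal.Quotient.mk _ f) =
      TrivSqZeroExt.inl (f.coeff 0) + TrivSqZeroExt.inr (f.coeff 1) :=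
  Jet.aeval_eps f

theorem Jet.trunc_comp_const (n : ℕ) :
    (Jet.trunc k B n).comp (Jet.const k B n) = TrivSqZeroExt.inlAlgHom k B B := by
  ext b : 1
  refine (Jet.trunc_mk (k := k) n (Polynomial.C b)).trans ?_
  simp

theorem Jet.trunc_surjective (n : ℕ) : Function.Surjective (Jet.trunc k B n) := fun x =>
  ⟨Ideal.Quotient.mk _ (Polynomial.C x.fst + Polynomial.C x.snd * Polynomial.X), by
    rw [Jet.trunc_mk]
    ext <;> simp⟩

theorem Jet.isNilpotent_ker_trunc (n : ℕ) : IsNilpotent (RingHom.ker (Jet.trunc k B n)) := by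
  refine ⟨n + 2, ?_⟩
  have h : RingHom.ker (Jet.trunc k B n) ≤
      Ideal.span {Ideal.Quotient.mk (Ideal.span {(Polynomial.X : Polynomial B) ^ (n + 2)})
        Polynomial.X} := fun x hx => by
    obtain ⟨f, rfl⟩ := Ideal.Quotient.mk_surjective x
    rw [RingHom.mem_ker, Jet.trunc_mk] at hx
    have h₀ : f.coeff 0 = 0 := by simpa using congrArg TrivSqZeroExt.fst hx
    exact Ideal.mem_span_singleton.2 (map_dvd _ (Polynomial.X_dvd_iff.2 h₀))
  refine eq_bot_iff.2 ((Ideal.pow_right_mono h (n + 2)).trans ?_)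
  rw [Ideal.span_singleton_pow, ← map_pow, Ideal.span_singleton_le_iff_mem, Ideal.mem_bot,
    Ideal.Quotient.eq_zero_iff_mem]
  exact Ideal.mem_span_singleton_self _

/-- Over a reduced ring, a jet which is nilpotent of small order vanishes to first order. -/
theorem Jet.trunc_eq_zero_of_pow_eq_zero [IsReduced B] {n : ℕ} {y : Jet B n}
    (hy : y ^ (n + 1) = 0) : Jet.trunc k B n y = 0 := by
  obtain ⟨f, rfl⟩ := Ideal.Quotient.mk_surjective y
  rw [← map_pow, Ideal.Quotient.eq_zero_iff_mem, Ideal.mem_span_singleton] at hy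
  have key : ∀ g : Polynomial B, Polynomial.X ∣ g ^ (n + 1) → g.coeff 0 = 0 := fun g hg => by
    rw [Polynomial.X_dvd_iff, Polynomial.coeff_zero_eq_eval_zero, Polynomial.eval_pow] at hg
    rw [Polynomial.coeff_zero_eq_eval_zero]
    exact eq_zero_of_pow_eq_zero hg
  have h₀ := key f ((dvd_pow_self _ (by omega)).trans hy)
  obtain ⟨g, rfl⟩ := Polynomial.X_dvd_iff.2 h₀
  have h₁ : g.coeff 0 = 0 := by
    refine key g ?_
    rw [mul_pow, show n + 2 = (n + 1) + 1 from rfl, pow_succ] at hy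
    obtain ⟨q, hq⟩ := hy
    refine ⟨q, (Polynomial.isRegular_X_pow (n + 1)).left ?_⟩
    simpa [mul_assoc] using hq
  rw [Jet.trunc_mk, h₀, Polynomial.coeff_X_mul, h₁]
  simp

theorem SymplecticForm.sum_smul_ham_apply (ω : SymplecticForm k A) {ι : Type*} (s : Finset ι)
    (c φ : ι → A) (a : A) :
    (∑ i ∈ s, c i • ω.ham (φ i)) a = ∑ i ∈ s, c i * ω.bracket a (φ i) := by
  classical
  induction s using Finset.induction_on with
  | empty => simp
  | insert i s hi ih =>
    rw [Finset.sum_insert hi, Finset.sum_insert hi, Derivation.add_apply, ih]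
    rfl

/-- Derivations of `R/I` into `A/J` along a formally smooth morphism `R/I → A/J` are induced by
vector fields on `Spec A` tangent to the subscheme of `J`. -/
theorem SymplecticForm.exists_derivation_extending [Algebra.Smooth k A] (ω : SymplecticForm k A)
    {I : Ideal R} {J : Ideal A} {σ : R →ₐ[k] A} (hIJ : I ≤ J.comap σ)
    (hσ : (Ideal.quotientMapₐ J σ hIJ).toRingHom.FormallySmooth) (δ : R →ₗ[k] A ⧸ J)
    (hδ : IsDerivationAlong ((Ideal.Quotient.mkₐ k J).comp σ) δ) (h0 : ∀ r ∈ I, δ r = 0) :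
    ∃ W : Derivation k A A, (∀ a ∈ J, W a ∈ J) ∧
      ∀ r, Ideal.Quotient.mk J (W (σ r)) = δ r := by
  let f : R ⧸ I →ₐ[k] TrivSqZeroExt (A ⧸ J) (A ⧸ J) :=
    Ideal.Quotient.liftₐ I (dualPoint _ δ hδ) fun r hr => by
      ext
      · rw [fst_dualPoint]
        exact Ideal.Quotient.eq_zero_iff_mem.2 (hIJ hr)
      · rw [snd_dualPoint, h0 r hr]
        rfl
  have hf : ∀ r, f (Ideal.Quotient.mk I r) = dualPoint _ δ hδ r := fun _ => rfl
  obtain ⟨g, hg, hg'⟩ := exists_lift_of_formallySmooth hσ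
    (TrivSqZeroExt.fstHom k (A ⧸ J) (A ⧸ J)) TrivSqZeroExt.fst_surjective
    ⟨2, by
      refine le_bot_iff.1 ?_
      rw [pow_two, Ideal.mul_le]
      intro x hx y hy
      rw [RingHom.mem_ker, TrivSqZeroExt.fstHom_apply] at hx hy
      rw [Ideal.mem_bot]
      ext <;> simp [hx, hy]⟩ f (AlgHom.id k _) (by
      rw [← AlgHom.cancel_right (Ideal.Quotient.mkₐ_surjective k I)]
      ext r
      change (f (Ideal.Quotient.mk I r)).fst = _
      rw [hf, fst_dualPoint]
      rfl)
  let e := Ideal.Quotient.mkₐ k J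
  let u := g.comp e
  have hu := isDerivationAlong_snd u
  have hu₀ : (TrivSqZeroExt.fstHom k _ _).comp u = e := by
    rw [← AlgHom.comp_assoc, hg]; rfl
  rw [hu₀] at hu
  obtain ⟨c, hc⟩ := ω.exists_eq_sum_bracket e _ hu
  let c' : A → A := fun a => Function.surjInv Ideal.Quotient.mk_surjective (c a)
  have hc' : ∀ a, Ideal.Quotient.mk J (c' a) = c a := fun a =>
    Function.surjInv_eq Ideal.Quotient.mk_surjective (c a)
  have hW : ∀ a, Ideal.Quotient.mk J ((∑ f ∈ c.support, c' f • ω.ham f) a) = (u a).snd :=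
    fun a => by
      refine Eq.trans ?_ (hc a).symm
      rw [Finsupp.sum, ω.sum_smul_ham_apply, map_sum]
      refine Finset.sum_congr rfl fun f _ => ?_
      rw [map_mul, hc']
      rfl
  refine ⟨∑ f ∈ c.support, c' f • ω.ham f, fun a ha => ?_, fun r => ?_⟩
  · rw [← Ideal.Quotient.eq_zero_iff_mem, hW]
    have : e a = 0 := Ideal.Quotient.eq_zero_iff_mem.2 ha
    simp [u, this]
  · rw [hW]
    have := DFunLike.congr_fun hg' (Ideal.Quotient.mk I r)
    have h' : u (σ r) = f (Ideal.Quotient.mk I r) := this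
    rw [h', hf, snd_dualPoint]

end Lifting

/-! ### Stabilizer subgroupoids are coisotropic -/

namespace ClosedSubgroupoid

variable {k : Type*} [CommRing k] {R : Type u₁} {A : Type u₂} [CommRing R]
    [CommRing A] [Algebra k R] [Algebra k A] {𝒢 : LieGroupoid k R A} {ω : SymplecticForm k A}
    (H : ClosedSubgroupoid 𝒢)

instance isReduced_arrows : IsReduced (A ⧸ H.arrows) :=
  (Ideal.isRadical_iff_quotient_reduced _).1 H.arrows_radical

/-- A function vanishing on `ℋ` is nilpotent on the scheme-theoretic fibre product `ℋ ×[S] ℋ`. -/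
theorem exists_prod_pow_eq_zero {a : A} (ha : a ∈ H.arrows) :
    ∃ m : ℕ, ∀ {D : Type u₂} [CommRing D] [Algebra k D] (g h : A →ₐ[k] D)
      (w : g.comp 𝒢.src = h.comp 𝒢.tgt), (∀ x ∈ H.arrows, g x = 0) → (∀ x ∈ H.arrows, h x = 0) →
      𝒢.prod g h w a ^ (m + 1) = 0 := by
  obtain ⟨m, hm⟩ := H.mul_mem ha
  refine ⟨m, fun {D} _ _ g h w hg hh => ?_⟩
  have hle : H.arrows.map (FibreProd.inl 𝒢.src 𝒢.tgt) ⊔ H.arrows.map (FibreProd.inr 𝒢.src 𝒢.tgt) ≤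
      RingHom.ker (FibreProd.lift g h w) := by
    refine sup_le (Ideal.map_le_iff_le_comap.2 fun x hx => ?_)
      (Ideal.map_le_iff_le_comap.2 fun x hx => ?_)
    · rw [Ideal.mem_comap, RingHom.mem_ker, FibreProd.lift_inl_apply, hg x hx]
    · rw [Ideal.mem_comap, RingHom.mem_ker, FibreProd.lift_inr_apply, hh x hx]
  have h₁ : FibreProd.lift g h w (𝒢.mul a ^ m) = 0 := hle hm
  rw [map_pow] at h₁
  rw [pow_succ]
  change FibreProd.lift g h w (𝒢.mul a) ^ m * _ = 0
  rw [h₁, zero_mul]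

variable {H}

/-- Along the units over `S`, the Hamiltonian vector field of `t^*s` is tangent to `ℋ`: it is the
section of the Lie algebroid of `ℋ` which corresponds to the covector `ds`. -/
theorem IsStabilizer.one_bracket_tgt_mem (hω : IsSymplecticGroupoid 𝒢 ω)
    (hS : IsCoisotropic (baseBracket 𝒢 ω) H.objects) (hH : H.IsStabilizer ω)
    {s : R} (hs : s ∈ H.objects) {a : A} (ha : a ∈ H.arrows) :
    𝒢.one (ω.bracket (𝒢.tgt s) a) ∈ H.objects := by
  obtain ⟨D, hD, hc⟩ := (hH.lieAlgebroid (KaehlerDifferential.D k R s)).2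
    ⟨fun F hF => by
      rw [Derivation.liftKaehlerDifferential_comp_D]
      exact hF s hs, fun h hh => by
      rw [sharp, Derivation.liftKaehlerDifferential_comp_D]
      exact hS s hs h hh⟩
  -- `E = X_a - X_{s^*1^*a}` is tangent to the units by `one_bracket`
  let E := ω.ham a - ω.ham (𝒢.src (𝒢.one a))
  have hF : IsDerivationAlong (AlgHom.id k R)
      (𝒢.one.toLinearMap ∘ₗ (ω.ham a).toLinearMap ∘ₗ 𝒢.tgt.toLinearMap) := fun r q => by
    simp
  let F : Derivation k R R := Derivation.mk' _ hF
  have h := hc E F fun g => by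
    have h := hω.one_bracket g a
    rw [ω.bracket_eq_ham, ω.bracket_eq_ham, ω.bracket_eq_ham] at h
    change 𝒢.one (ω.ham a g - ω.ham _ g) = 𝒢.one (ω.ham a (𝒢.tgt (𝒢.one g)))
    rw [map_sub, h]
    ring
  have hE : ω.form D E = D (𝒢.src (𝒢.one a)) - D a := by
    rw [ω.form_skew, map_sub, LinearMap.sub_apply, ω.form_ham, ω.form_ham]
    ring
  rw [Derivation.liftKaehlerDifferential_comp_D, hE, map_sub] at h
  have h' : F s = 𝒢.one (ω.bracket (𝒢.tgt s) a) := rfl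
  rw [h'] at h
  have := sub_mem (sub_mem (hD.1 (𝒢.one a)) (hD.2 a ha)) h
  simpa using this

/-- Along the units over `S`, the Hamiltonian vector field of `s^*s` is tangent to `ℋ`. -/
theorem IsStabilizer.one_bracket_src_mem (hω : IsSymplecticGroupoid 𝒢 ω)
    (hS : IsCoisotropic (baseBracket 𝒢 ω) H.objects) (hH : H.IsStabilizer ω)
    {s : R} (hs : s ∈ H.objects) {a : A} (ha : a ∈ H.arrows) :
    𝒢.one (ω.bracket (𝒢.src s) a) ∈ H.objects := by
  rw [hω.one_bracket, 𝒢.one_src_apply, hω.one_bracket_src_src]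
  exact add_mem (neg_mem (hS s hs _ (H.one_mem ha))) (hH.one_bracket_tgt_mem hω hS hs ha)

/-- The right-invariant vector field of `t^*s` is tangent to `ℋ`. The equations of `ℋ` are only
nilpotent on `ℋ ×[S] ℋ`, so that a tangent vector to the first factor at a unit is prolonged to a
jet of high order before it is translated. -/
theorem IsStabilizer.bracket_tgt_mem (hω : IsSymplecticGroupoid 𝒢 ω)
    (hS : IsCoisotropic (baseBracket 𝒢 ω) H.objects) (hH : H.IsStabilizer ω)
    {s : R} (hs : s ∈ H.objects) {a : A} (ha : a ∈ H.arrows) :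
    ω.bracket (𝒢.tgt s) a ∈ H.arrows := by
  have hb := ω.isSkewBiderivation_bracket
  let B := A ⧸ H.arrows
  let q : A →ₐ[k] B := Ideal.Quotient.mkₐ k H.arrows
  have hq : ∀ {x}, q x = 0 ↔ x ∈ H.arrows := Ideal.Quotient.eq_zero_iff_mem
  let e : A →ₐ[k] B := q.comp (𝒢.tgt.comp 𝒢.one)
  let d : A →ₗ[k] B := (q.comp 𝒢.tgt).toLinearMap ∘ₗ 𝒢.one.toLinearMap ∘ₗ ω.bracket (𝒢.tgt s)
  have hd : IsDerivationAlong e d := fun x y => by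
    simp [d, e, hb.leibniz]
    ring
  let γ₀ := dualPoint e d hd
  let γ : B →ₐ[k] TrivSqZeroExt B B := Ideal.Quotient.liftₐ H.arrows γ₀ fun x hx => by
    ext
    · rw [fst_dualPoint]
      exact hq.2 (H.tgt_mem (H.one_mem hx))
    · rw [snd_dualPoint]
      exact hq.2 (H.tgt_mem (hH.one_bracket_tgt_mem hω hS hs hx))
  obtain ⟨m, hm⟩ := H.exists_prod_pow_eq_zero ha
  obtain ⟨γm, h₁, h₂⟩ := exists_lift_of_formallySmooth hH.smooth_src.formallySmooth
    (Jet.trunc k B m) (Jet.trunc_surjective m) (Jet.isNilpotent_ker_trunc m)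
    ((Jet.const k B m).comp H.tgtH) γ (by
      rw [← AlgHom.comp_assoc, Jet.trunc_comp_const,
        ← AlgHom.cancel_right (Ideal.Quotient.mkₐ_surjective k H.objects)]
      ext r
      · change q (𝒢.tgt r) = (γ₀ (𝒢.src r)).fst
        simp [γ₀, e]
      · change 0 = (γ₀ (𝒢.src r)).snd
        simp [γ₀, d, hω.bracket_tgt_src])
  have w : (γm.comp q).comp 𝒢.src = ((Jet.const k B m).comp q).comp 𝒢.tgt := by
    ext r : 1
    exact DFunLike.congr_fun h₂ (Ideal.Quotient.mk _ r)
  have h₃ := Jet.trunc_eq_zero_of_pow_eq_zero (k := k) (hm (γm.comp q) ((Jet.const k B m).comp q) w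
    (fun x hx => by rw [AlgHom.comp_apply, hq.2 hx, map_zero])
    (fun x hx => by rw [AlgHom.comp_apply, hq.2 hx, map_zero]))
  have e₁ : (Jet.trunc k B m).comp (γm.comp q) = γ₀ := by
    rw [← AlgHom.comp_assoc, h₁]
    rfl
  have e₂ : (Jet.trunc k B m).comp ((Jet.const k B m).comp q) =
      (TrivSqZeroExt.inlAlgHom k B B).comp q := by
    rw [← AlgHom.comp_assoc, Jet.trunc_comp_const]
  obtain ⟨z, hz⟩ := FibreProd.ofTensor_surjective 𝒢.src 𝒢.tgt (𝒢.mul a)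
  have h₄ : Algebra.TensorProduct.productMap γ₀ ((TrivSqZeroExt.inlAlgHom k B B).comp q) z = 0 := by
    have w' : γ₀.comp 𝒢.src = ((TrivSqZeroExt.inlAlgHom k B B).comp q).comp 𝒢.tgt := by
      rw [← e₁, ← e₂, AlgHom.comp_assoc, w, ← AlgHom.comp_assoc]
    rw [← FibreProd.lift_ofTensor _ _ w', hz, ← h₃]
    exact (DFunLike.congr_fun ((𝒢.comp_prod (Jet.trunc k B m) _ _ w).trans
      (𝒢.prod_congr e₁ e₂ _)) a).symm
  rw [← hq, ← 𝒢.productMap_one_id (hω.mul_bracket (z := 𝒢.tgt s ⊗ₜ 1) (w := z)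
    (by simp [𝒢.mul_tgt_apply]) hz).symm]
  refine Eq.trans ?_ (congrArg TrivSqZeroExt.snd h₄)
  clear hz h₄
  induction z using TensorProduct.induction_on with
  | zero => simp
  | add x y hx hy => simp only [map_add, hx, hy, TrivSqZeroExt.snd_add]
  | tmul x y =>
    rw [prodBracket_left hb]
    simp [γ₀, d, mul_comm]

/-- The left-invariant vector field of `s^*s` is tangent to `ℋ`. -/
theorem IsStabilizer.bracket_src_mem (hω : IsSymplecticGroupoid 𝒢 ω)
    (hS : IsCoisotropic (baseBracket 𝒢 ω) H.objects) (hH : H.IsStabilizer ω)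
    {s : R} (hs : s ∈ H.objects) {a : A} (ha : a ∈ H.arrows) :
    ω.bracket (𝒢.src s) a ∈ H.arrows := by
  have hb := ω.isSkewBiderivation_bracket
  let B := A ⧸ H.arrows
  let q : A →ₐ[k] B := Ideal.Quotient.mkₐ k H.arrows
  have hq : ∀ {x}, q x = 0 ↔ x ∈ H.arrows := Ideal.Quotient.eq_zero_iff_mem
  let e : A →ₐ[k] B := q.comp (𝒢.src.comp 𝒢.one)
  let d : A →ₗ[k] B := (q.comp 𝒢.src).toLinearMap ∘ₗ 𝒢.one.toLinearMap ∘ₗ ω.bracket (𝒢.src s)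
  have hd : IsDerivationAlong e d := fun x y => by
    simp [d, e, hb.leibniz]
    ring
  let γ₀ := dualPoint e d hd
  let γ : B →ₐ[k] TrivSqZeroExt B B := Ideal.Quotient.liftₐ H.arrows γ₀ fun x hx => by
    ext
    · rw [fst_dualPoint]
      exact hq.2 (H.src_mem (H.one_mem hx))
    · rw [snd_dualPoint]
      exact hq.2 (H.src_mem (hH.one_bracket_src_mem hω hS hs hx))
  obtain ⟨m, hm⟩ := H.exists_prod_pow_eq_zero ha
  obtain ⟨γm, h₁, h₂⟩ := exists_lift_of_formallySmooth hH.smooth_tgt.formallySmooth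
    (Jet.trunc k B m) (Jet.trunc_surjective m) (Jet.isNilpotent_ker_trunc m)
    ((Jet.const k B m).comp H.srcH) γ (by
      rw [← AlgHom.comp_assoc, Jet.trunc_comp_const,
        ← AlgHom.cancel_right (Ideal.Quotient.mkₐ_surjective k H.objects)]
      ext r
      · change q (𝒢.src r) = (γ₀ (𝒢.tgt r)).fst
        simp [γ₀, e]
      · change 0 = (γ₀ (𝒢.tgt r)).snd
        simp [γ₀, d, hω.bracket_src_tgt])
  have w : ((Jet.const k B m).comp q).comp 𝒢.src = (γm.comp q).comp 𝒢.tgt := by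
    ext r : 1
    exact (DFunLike.congr_fun h₂ (Ideal.Quotient.mk _ r)).symm
  have h₃ := Jet.trunc_eq_zero_of_pow_eq_zero (k := k) (hm ((Jet.const k B m).comp q) (γm.comp q) w
    (fun x hx => by rw [AlgHom.comp_apply, hq.2 hx, map_zero])
    (fun x hx => by rw [AlgHom.comp_apply, hq.2 hx, map_zero]))
  have e₁ : (Jet.trunc k B m).comp (γm.comp q) = γ₀ := by
    rw [← AlgHom.comp_assoc, h₁]
    rfl
  have e₂ : (Jet.trunc k B m).comp ((Jet.const k B m).comp q) =
      (TrivSqZeroExt.inlAlgHom k B B).comp q := by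
    rw [← AlgHom.comp_assoc, Jet.trunc_comp_const]
  obtain ⟨z, hz⟩ := FibreProd.ofTensor_surjective 𝒢.src 𝒢.tgt (𝒢.mul a)
  have h₄ : Algebra.TensorProduct.productMap ((TrivSqZeroExt.inlAlgHom k B B).comp q) γ₀ z = 0 := by
    have w' : ((TrivSqZeroExt.inlAlgHom k B B).comp q).comp 𝒢.src = γ₀.comp 𝒢.tgt := by
      rw [← e₁, ← e₂, AlgHom.comp_assoc, w, ← AlgHom.comp_assoc]
    rw [← FibreProd.lift_ofTensor _ _ w', hz, ← h₃]
    exact (DFunLike.congr_fun ((𝒢.comp_prod (Jet.trunc k B m) _ _ w).trans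
      (𝒢.prod_congr e₂ e₁ _)) a).symm
  rw [← hq, hb.skew, ← 𝒢.productMap_id_one (hω.mul_bracket (w := 1 ⊗ₜ 𝒢.src s) (z := z) hz
    (by simp [𝒢.mul_src_apply])).symm, map_neg, neg_eq_zero, ← neg_eq_zero]
  refine Eq.trans ?_ (congrArg TrivSqZeroExt.snd h₄)
  clear hz h₄
  induction z using TensorProduct.induction_on with
  | zero => simp
  | add x y hx hy =>
    simp only [map_add, TrivSqZeroExt.snd_add, ← hx, ← hy, LinearMap.add_apply, neg_add]
  | tmul x y =>
    rw [prodBracket_right hb, hb.skew]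
    simp only [TensorProduct.tmul_neg, map_neg]
    refine (neg_neg _).trans ?_
    simp [γ₀, d]

theorem _root_.AffineGroupoid.SymplecticForm.form_mem_of_forall_mem [Algebra.Smooth k A]
    {J : Ideal A} {D : Derivation k A A} (hD : ∀ a, D a ∈ J) (E : Derivation k A A) :
    ω.form D E ∈ J := by
  induction ω.mem_span_ham E using Submodule.span_induction with
  | mem x hx =>
    obtain ⟨f, rfl⟩ := hx
    rw [ω.form_skew, ω.form_ham]
    exact neg_mem (hD f)
  | zero => simp
  | add x y _ _ hx hy => rw [map_add]; exact add_mem hx hy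
  | smul c x _ hx => rw [map_smul, smul_eq_mul]; exact Ideal.mul_mem_left _ _ hx

/-- A stabilizer subgroupoid is coisotropic, hence Lagrangian. -/
theorem IsStabilizer.isCoisotropic (hω : IsSymplecticGroupoid 𝒢 ω)
    (hS : IsCoisotropic (baseBracket 𝒢 ω) H.objects) (hH : H.IsStabilizer ω) :
    IsCoisotropic ω.bracket H.arrows := by
  intro b hbm a ham
  have := 𝒢.smooth_arrows
  have hb := ω.isSkewBiderivation_bracket
  let q : A →ₐ[k] A ⧸ H.arrows := Ideal.Quotient.mkₐ k H.arrows
  have hq : ∀ {x}, q x = 0 ↔ x ∈ H.arrows := Ideal.Quotient.eq_zero_iff_mem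
  -- `U` is tangent to `ℋ` and has the same image as `X_a` under the differential of the target
  obtain ⟨U, hU, hUt⟩ := ω.exists_derivation_extending H.tgt_mem hH.smooth_tgt.formallySmooth
    (-(q.toLinearMap ∘ₗ ω.bracket a ∘ₗ 𝒢.tgt.toLinearMap))
    (fun x y => by simp [hb.leibniz, q]; ring)
    (fun r hr => by
      simpa using hq.2 (by rw [hb.skew]; exact neg_mem (hH.bracket_tgt_mem hω hS hr ham)))
  -- `W` is tangent to `ℋ` and agrees with minus `X_b` on functions pulled back along the source
  obtain ⟨W, hW, hWs⟩ := ω.exists_derivation_extending H.src_mem hH.smooth_src.formallySmooth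
    (q.toLinearMap ∘ₗ ω.bracket b ∘ₗ 𝒢.src.toLinearMap)
    (fun x y => by simp [hb.leibniz, q]; ring)
    (fun r hr => by
      simpa using hq.2 (by rw [hb.skew]; exact neg_mem (hH.bracket_src_mem hω hS hr hbm)))
  -- `V = X_a - U` is tangent to the target fibres along `ℋ`
  let V := ω.ham a - U
  obtain ⟨c, hc⟩ := hω.exists_eq_sum_bracket_src q (q.toLinearMap ∘ₗ V.toLinearMap)
    (IsDerivationAlong.comp_derivation q V) (fun r => by
      change q (ω.bracket (𝒢.tgt r) a - U (𝒢.tgt r)) = 0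
      rw [map_sub]
      refine sub_eq_zero.2 (Eq.trans ?_ (hUt r).symm)
      simp [hb.skew a])
  let c' : A → A := fun f => Function.surjInv Ideal.Quotient.mk_surjective (c f)
  have hc' : ∀ f, q (c' f) = c f := fun f => Function.surjInv_eq Ideal.Quotient.mk_surjective (c f)
  let V' := ∑ f ∈ c.support, c' f • ω.ham (𝒢.src (𝒢.one f))
  have hV' : ∀ x, V' x = ∑ f ∈ c.support, c' f * ω.bracket x (𝒢.src (𝒢.one f)) :=
    ω.sum_smul_ham_apply _ _ _
  have hVV' : ∀ x, q (V x) = q (V' x) := fun x => by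
    rw [hV', map_sum]
    refine (hc x).trans (Finset.sum_congr rfl fun f _ => ?_)
    rw [map_mul, hc']
  have h₁ : ω.form (V - V') W ∈ H.arrows := ω.form_mem_of_forall_mem (fun x => by
    rw [← hq, Derivation.sub_apply, map_sub, hVV', sub_self]) W
  have h₂ : ω.form V W ∈ H.arrows := by
    rw [map_sub, LinearMap.sub_apply, ω.form_ham]
    exact sub_mem (hW a ham) (hH.isotropic U W hU hW)
  have h₃ : ω.form V' W ∈ H.arrows := by
    have := sub_mem h₂ h₁
    rwa [map_sub ω.form V V', LinearMap.sub_apply, sub_sub_cancel] at this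
  have h₄ : q (ω.form V' W) = q (V' b) := by
    rw [hV', map_sum, LinearMap.sum_apply, map_sum, map_sum]
    refine Finset.sum_congr rfl fun f _ => ?_
    rw [map_smul, LinearMap.smul_apply, ω.form_ham, smul_eq_mul, map_mul, map_mul]
    exact congrArg (q (c' f) * ·) (hWs _)
  have h₅ : V b ∈ H.arrows := by
    rw [← hq, hVV', ← h₄, hq]
    exact h₃
  have := add_mem h₅ (hU b hbm)
  rw [Derivation.sub_apply, sub_add_cancel] at this
  exact this

end ClosedSubgroupoid

/-! ### Brackets on generators and on quotients -/

section Quotient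

variable {k : Type*} [CommRing k] {A B : Type*} [CommRing A] [Algebra k A] [CommRing B]
  [Algebra k B] {b : A →ₗ[k] A →ₗ[k] A}

theorem IsSkewBiderivation.mem_span (hb : IsSkewBiderivation b) {G : Set A} {x : A}
    (hx : ∀ g ∈ G, b x g ∈ Ideal.span G) {y : A} (hy : y ∈ Ideal.span G) :
    b x y ∈ Ideal.span G := by
  induction hy using Submodule.span_induction with
  | mem g hg => exact hx g hg
  | zero => simp
  | add y z _ _ hy hz => rw [map_add]; exact add_mem hy hz
  | smul c y hy' hy =>
    rw [smul_eq_mul, hb.leibniz]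
    exact add_mem (Ideal.mul_mem_left _ _ hy') (Ideal.mul_mem_left _ _ hy)

theorem IsSkewBiderivation.isCoisotropic_span (hb : IsSkewBiderivation b) {G : Set A}
    (hG : ∀ g ∈ G, ∀ g' ∈ G, b g g' ∈ Ideal.span G) : IsCoisotropic b (Ideal.span G) := by
  intro x hx y hy
  rw [hb.skew]
  refine neg_mem (hb.mem_span (fun g hg => ?_) hx)
  rw [hb.skew]
  exact neg_mem (hb.mem_span (hG g hg) hy)

/-- A bracket for which the kernel of a surjection is a Poisson ideal descends. -/
theorem IsSkewBiderivation.exists_descent (hb : IsSkewBiderivation b) (π : A →ₐ[k] B)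
    (hπ : Function.Surjective π) (hker : ∀ x y, π x = 0 → π (b x y) = 0) :
    ∃ c : B →ₗ[k] B →ₗ[k] B, ∀ x y, c (π x) (π y) = π (b x y) := by
  have hl : ∀ x x' y, π x = π x' → π (b x y) = π (b x' y) := fun x x' y h => by
    rw [← sub_eq_zero, ← map_sub, ← LinearMap.sub_apply, ← map_sub]
    exact hker _ _ (by rw [map_sub, h, sub_self])
  have hr : ∀ x y y', π y = π y' → π (b x y) = π (b x y') := fun x y y' h => by
    rw [hb.skew x y, hb.skew x y', map_neg, map_neg, hl y y' x h]
  have hs := Function.surjInv_eq hπ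
  refine ⟨LinearMap.mk₂ k
    (fun x y => π (b (Function.surjInv hπ x) (Function.surjInv hπ y))) (fun x x' y => ?_)
    (fun c x y => ?_) (fun x y y' => ?_) (fun c x y => ?_), fun x y => ?_⟩
  · rw [hl _ (Function.surjInv hπ x + Function.surjInv hπ x') _ (by simp [hs])]
    simp
  · rw [hl _ (c • Function.surjInv hπ x) _ (by simp [hs])]
    simp
  · rw [hr _ _ (Function.surjInv hπ y + Function.surjInv hπ y') (by simp [hs])]
    simp
  · rw [hr _ _ (c • Function.surjInv hπ y) (by simp [hs])]
    simp
  · rw [LinearMap.mk₂_apply, hl _ x _ (hs _), hr _ _ y (hs _)]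

theorem IsPoissonBracket.of_surjective (hb : IsPoissonBracket b) (π : A →ₐ[k] B)
    (hπ : Function.Surjective π) {c : B →ₗ[k] B →ₗ[k] B}
    (h : ∀ x y, c (π x) (π y) = π (b x y)) : IsPoissonBracket c where
  self_eq_zero f := by
    obtain ⟨f, rfl⟩ := hπ f
    rw [h, hb.self_eq_zero, map_zero]
  jacobi f g l := by
    obtain ⟨f, rfl⟩ := hπ f
    obtain ⟨g, rfl⟩ := hπ g
    obtain ⟨l, rfl⟩ := hπ l
    simp only [h]
    rw [← map_add, ← map_add, hb.jacobi, map_zero]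
  leibniz f g l := by
    obtain ⟨f, rfl⟩ := hπ f
    obtain ⟨g, rfl⟩ := hπ g
    obtain ⟨l, rfl⟩ := hπ l
    rw [← map_mul, h, h, h, hb.leibniz, map_add, map_mul, map_mul]

end Quotient

/-! ### The Poisson algebra of functions with invariant restriction -/

namespace ClosedSubgroupoid

variable {k : Type*} [CommRing k] {R : Type u₁} {A : Type u₂} {M : Type u₃} [CommRing R]
    [CommRing A] [CommRing M] [Algebra k R] [Algebra k A] [Algebra k M] {𝒢 : LieGroupoid k R A}
    {ω : SymplecticForm k A} {H : ClosedSubgroupoid 𝒢} {α : Action 𝒢 M} {P : M →ₗ[k] M →ₗ[k] M}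

theorem _root_.AffineGroupoid.IsHamiltonian.coact_bracket (hα : IsHamiltonian ω α P)
    (hP : IsSkewBiderivation P) {x y : M} {z w : A ⊗[k] M}
    (hz : FibreProd.ofTensor 𝒢.src α.moment z = α.coact x)
    (hw : FibreProd.ofTensor 𝒢.src α.moment w = α.coact y) :
    α.coact (P x y) = FibreProd.ofTensor 𝒢.src α.moment (prodBracket ω.bracket P z w) :=
  map_bracket_of_isCoisotropic_graphIdeal ω.isSkewBiderivation_bracket hP hP hα hz hw

/-- The functions on `ν⁻¹(S)` pulled back from `S` act trivially on functions with invariant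
restriction: for `s` vanishing on `S`, the vector field of `ν^*s` is the infinitesimal action of
a section of the Lie algebroid of `ℋ`. -/
theorem IsStabilizer.bracket_moment_mem (hω : IsSymplecticGroupoid 𝒢 ω)
    (hS : IsCoisotropic (baseBracket 𝒢 ω) H.objects) (hH : H.IsStabilizer ω)
    (hα : IsHamiltonian ω α P) (hP : IsSkewBiderivation P) {s : R} (hs : s ∈ H.objects) {f : M}
    (hf : H.j α f ∈ H.invariants α) : P (α.moment s) f ∈ H.fibreIdeal α := by
  have hb := ω.isSkewBiderivation_bracket
  let F := H.Fibre α
  let e : A →ₐ[k] F := ((H.j α).comp α.moment).comp 𝒢.one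
  let d : A →ₗ[k] F := e.toLinearMap ∘ₗ ω.bracket (𝒢.tgt s)
  have hd : IsDerivationAlong e d := fun x y => by
    simp [d, hb.leibniz]
    ring
  let γ₀ := dualPoint e d hd
  let γ : A ⧸ H.arrows →ₐ[k] TrivSqZeroExt F F := Ideal.Quotient.liftₐ H.arrows γ₀ fun x hx => by
    ext
    · rw [fst_dualPoint]
      exact H.j_moment α (H.one_mem hx)
    · rw [snd_dualPoint]
      exact H.j_moment α (hH.one_bracket_tgt_mem hω hS hs hx)
  have w : γ.comp H.srcH = (TrivSqZeroExt.inlAlgHom k F F).comp (H.momentH α) := by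
    rw [← AlgHom.cancel_right (Ideal.Quotient.mkₐ_surjective k H.objects)]
    ext r
    · change (γ₀ (𝒢.src r)).fst = H.j α (α.moment r)
      simp [γ₀, e]
    · change (γ₀ (𝒢.src r)).snd = 0
      simp [γ₀, d, hω.bracket_tgt_src]
  obtain ⟨z, hz⟩ := FibreProd.ofTensor_surjective 𝒢.src α.moment (α.coact f)
  have h₁ : FibreProd.lift γ (TrivSqZeroExt.inlAlgHom k F F) w
      (H.restrict α (FibreProd.ofTensor 𝒢.src α.moment z)) =
      TrivSqZeroExt.inl (H.j α f) := by
    rw [hz]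
    have h₂ := (H.mem_invariants α).1 hf
    change H.restrict α (α.coact f) = _ at h₂
    rw [h₂, FibreProd.lift_inr_apply]
    rfl
  have h₂ : α.coact (α.moment s) = FibreProd.inl 𝒢.src α.moment (𝒢.tgt s) :=
    DFunLike.congr_fun α.coact_moment s
  have h₃ := hα.coact_bracket hP (x := α.moment s) (z := 𝒢.tgt s ⊗ₜ 1) (by simp [h₂]) hz
  have w' : (α.moment.comp 𝒢.one).comp 𝒢.src = (AlgHom.id k M).comp α.moment := by
    rw [AlgHom.comp_assoc, 𝒢.one_src]; rfl
  have h₄ := DFunLike.congr_fun α.one_coact (P (α.moment s) f)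
  rw [AlgHom.comp_apply, h₃, FibreProd.lift_ofTensor] at h₄
  rw [← H.j_eq_zero_iff α, ← AlgHom.id_apply (R := k) (P (α.moment s) f), ← h₄]
  refine Eq.trans ?_ (congrArg TrivSqZeroExt.snd h₁)
  clear hz h₁ h₃ h₄
  induction z using TensorProduct.induction_on with
  | zero => simp
  | add x y hx hy => simp only [map_add, hx, hy, TrivSqZeroExt.snd_add]
  | tmul x y =>
    have hγ : γ (Ideal.Quotient.mkₐ k H.arrows x) = γ₀ x := rfl
    rw [prodBracket_left hP]
    simp only [FibreProd.ofTensor_tmul, map_mul, H.restrict_inl_apply, H.restrict_inr_apply,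
      FibreProd.lift_inl_apply, FibreProd.lift_inr_apply, hγ]
    simp [γ₀, d, e]

/-- The ideal of `ν⁻¹(S)` is a Poisson ideal in the functions with invariant restriction. -/
theorem IsStabilizer.bracket_fibreIdeal_mem (hω : IsSymplecticGroupoid 𝒢 ω)
    (hS : IsCoisotropic (baseBracket 𝒢 ω) H.objects) (hH : H.IsStabilizer ω)
    (hα : IsHamiltonian ω α P) (hP : IsSkewBiderivation P) {x f : M} (hx : x ∈ H.fibreIdeal α)
    (hf : H.j α f ∈ H.invariants α) : P f x ∈ H.fibreIdeal α := by
  refine hP.mem_span (G := α.moment '' H.objects) ?_ hx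
  rintro _ ⟨s, hs, rfl⟩
  rw [hP.skew]
  exact neg_mem (hH.bracket_moment_mem hω hS hα hP hs hf)

variable (H α) in
theorem ker_restrict_le :
    RingHom.ker (H.restrict α) ≤ H.arrows.map (FibreProd.inl 𝒢.src α.moment) := by
  set J := H.arrows.map (FibreProd.inl 𝒢.src α.moment)
  let q := Ideal.Quotient.mkₐ k J
  have hq : ∀ a ∈ H.arrows, q (FibreProd.inl 𝒢.src α.moment a) = 0 := fun a ha =>
    Ideal.Quotient.eq_zero_iff_mem.2 (Ideal.mem_map_of_mem _ ha)
  let f : A ⧸ H.arrows →ₐ[k] FibreProd 𝒢.src α.moment ⧸ J :=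
    Ideal.Quotient.liftₐ _ (q.comp (FibreProd.inl _ _)) hq
  let g : H.Fibre α →ₐ[k] FibreProd 𝒢.src α.moment ⧸ J :=
    Ideal.Quotient.liftₐ _ (q.comp (FibreProd.inr _ _)) fun m hm => by
      suffices h : H.fibreIdeal α ≤ RingHom.ker (q.comp (FibreProd.inr 𝒢.src α.moment)) from h hm
      refine Ideal.map_le_iff_le_comap.2 fun r hr => ?_
      rw [Ideal.mem_comap, RingHom.mem_ker, AlgHom.comp_apply, ← FibreProd.inl_comp_apply]
      exact hq _ (H.src_mem hr)
  let Ψ : FibreProd H.srcH (H.momentH α) →ₐ[k] FibreProd 𝒢.src α.moment ⧸ J :=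
    FibreProd.lift f g (by
      rw [← AlgHom.cancel_right (Ideal.Quotient.mkₐ_surjective k H.objects)]
      ext r
      change q (FibreProd.inl _ _ (𝒢.src r)) = q (FibreProd.inr _ _ (α.moment r))
      rw [FibreProd.inl_comp_apply])
  have hΨ : Ψ.comp (H.restrict α) = q := by
    apply FibreProd.hom_ext
    · ext a
      simp only [AlgHom.comp_apply, restrict_inl_apply, Ψ, FibreProd.lift_inl_apply]
      rfl
    · ext m
      simp only [AlgHom.comp_apply, restrict_inr_apply, Ψ, FibreProd.lift_inr_apply]
      rfl
  intro x hx
  have h₁ := DFunLike.congr_fun hΨ x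
  rw [AlgHom.comp_apply, (RingHom.mem_ker).1 hx, map_zero] at h₁
  exact Ideal.Quotient.eq_zero_iff_mem.1 h₁.symm

/-- The functions with invariant restriction to `ν⁻¹(S)` are closed under the bracket, because `ℋ`
is coisotropic. -/
theorem IsStabilizer.bracket_mem_invariants (hω : IsSymplecticGroupoid 𝒢 ω)
    (hS : IsCoisotropic (baseBracket 𝒢 ω) H.objects) (hH : H.IsStabilizer ω)
    (hα : IsHamiltonian ω α P) (hP : IsSkewBiderivation P) {f g : M}
    (hf : H.j α f ∈ H.invariants α) (hg : H.j α g ∈ H.invariants α) :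
    H.j α (P f g) ∈ H.invariants α := by
  have hb := ω.isSkewBiderivation_bracket
  have hp := hb.prodBracket hP
  let J : Ideal (A ⊗[k] M) :=
    H.arrows.map (Algebra.TensorProduct.includeLeft : A →ₐ[k] A ⊗[k] M)
  -- invariance means that the coaction is represented by `1 ⊗ f` modulo the equations of `ℋ`
  have key : ∀ f, H.j α f ∈ H.invariants α →
      ∃ y ∈ J, FibreProd.ofTensor 𝒢.src α.moment (1 ⊗ₜ f + y) = α.coact f := fun f hf => by
    have h₁ := (H.mem_invariants α).1 hf
    change H.restrict α (α.coact f) = _ at h₁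
    have h₂ : α.coact f - FibreProd.inr 𝒢.src α.moment f ∈
        J.map (FibreProd.ofTensor 𝒢.src α.moment) := by
      have h₃ : (FibreProd.ofTensor 𝒢.src α.moment).toRingHom.comp
          (Algebra.TensorProduct.includeLeft : A →ₐ[k] A ⊗[k] M).toRingHom =
          (FibreProd.inl 𝒢.src α.moment).toRingHom := by
        ext; simp
      have h₄ := H.ker_restrict_le α (x := α.coact f - FibreProd.inr 𝒢.src α.moment f) (by
        rw [RingHom.mem_ker, map_sub, h₁, restrict_inr_apply, sub_self])
      have h₅ := Ideal.map_map (I := H.arrows)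
        (Algebra.TensorProduct.includeLeft : A →ₐ[k] A ⊗[k] M).toRingHom
        (FibreProd.ofTensor 𝒢.src α.moment).toRingHom
      rw [h₃] at h₅
      exact h₅.symm ▸ h₄
    obtain ⟨y, hy, hy'⟩ := (Ideal.mem_map_iff_of_surjective _
      (FibreProd.ofTensor_surjective 𝒢.src α.moment)).1 h₂
    exact ⟨y, hy, by rw [map_add, hy']; simp⟩
  obtain ⟨y, hy, hy'⟩ := key f hf
  obtain ⟨w, hw, hw'⟩ := key g hg
  have hJ : IsCoisotropic (prodBracket ω.bracket P) J := by
    refine hp.isCoisotropic_span ?_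
    rintro _ ⟨a, ha, rfl⟩ _ ⟨a', ha', rfl⟩
    refine Ideal.subset_span ⟨ω.bracket a a', hH.isCoisotropic hω hS a ha a' ha', ?_⟩
    exact (prodBracket_left hP a a' 1).symm
  have hJ' : ∀ f : M, ∀ y ∈ J, prodBracket ω.bracket P (1 ⊗ₜ f) y ∈ J := fun f y hy => by
    refine hp.mem_span ?_ hy
    rintro _ ⟨a, ha, rfl⟩
    have : prodBracket ω.bracket P (1 ⊗ₜ f) (a ⊗ₜ 1) = 0 := by
      simp [hb.one_left, hP.one_right]
    exact this.symm ▸ zero_mem _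
  have h₁ : prodBracket ω.bracket P (1 ⊗ₜ f + y) (1 ⊗ₜ g + w) - 1 ⊗ₜ P f g ∈ J := by
    have h₂ : prodBracket ω.bracket P (1 ⊗ₜ f) (1 ⊗ₜ g) = 1 ⊗ₜ P f g := by
      simp [hb.one_left]
    rw [map_add, map_add, LinearMap.add_apply, LinearMap.add_apply, h₂, hp.skew y (1 ⊗ₜ g)]
    have h₃ := add_mem (add_mem (neg_mem (hJ' g y hy)) (hJ' f w hw)) (hJ y hy w hw)
    convert! h₃ using 1
    ring
  have h₂ : J ≤ RingHom.ker ((H.restrict α).comp (FibreProd.ofTensor 𝒢.src α.moment)) := by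
    refine Ideal.map_le_iff_le_comap.2 fun a ha => ?_
    have : Ideal.Quotient.mkₐ k H.arrows a = 0 := Ideal.Quotient.eq_zero_iff_mem.2 ha
    rw [Ideal.mem_comap, RingHom.mem_ker]
    simp only [AlgHom.comp_apply, Algebra.TensorProduct.includeLeft_apply,
      FibreProd.ofTensor_tmul, map_one, mul_one, restrict_inl_apply, this, map_zero]
  rw [H.mem_invariants]
  change H.restrict α (α.coact (P f g)) = _
  rw [hα.coact_bracket hP hy' hw']
  have h₃ := h₂ h₁
  rw [RingHom.mem_ker, map_sub, sub_eq_zero] at h₃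
  refine Eq.trans h₃ ?_
  simp

/-- The functions on `Spec M` whose restriction to `ν⁻¹(S)` is invariant. -/
def liftedInvariants (H : ClosedSubgroupoid 𝒢) (α : Action 𝒢 M) : Subalgebra k M :=
  (H.invariants α).comap (H.j α)

/-- Restriction to `ν⁻¹(S)` of functions with invariant restriction. -/
def restrictInvariants (H : ClosedSubgroupoid 𝒢) (α : Action 𝒢 M) :
    H.liftedInvariants α →ₐ[k] H.invariants α :=
  ((H.j α).comp (H.liftedInvariants α).val).codRestrict _ fun f => f.2

theorem restrictInvariants_surjective : Function.Surjective (H.restrictInvariants α) := fun b => by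
  obtain ⟨f, hf⟩ := H.j_surjective α b
  exact ⟨⟨f, by change H.j α f ∈ H.invariants α; rw [hf]; exact b.2⟩, Subtype.ext hf⟩

/-- The bracket of functions with invariant restriction. -/
def IsStabilizer.liftedBracket (hω : IsSymplecticGroupoid 𝒢 ω)
    (hS : IsCoisotropic (baseBracket 𝒢 ω) H.objects) (hH : H.IsStabilizer ω)
    (hα : IsHamiltonian ω α P) (hP : IsSkewBiderivation P) :
    H.liftedInvariants α →ₗ[k] H.liftedInvariants α →ₗ[k] H.liftedInvariants α :=
  LinearMap.mk₂ k (fun f g => ⟨P f g, hH.bracket_mem_invariants hω hS hα hP f.2 g.2⟩)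
    (fun _ _ _ => Subtype.ext (by simp)) (fun _ _ _ => Subtype.ext (by simp))
    (fun _ _ _ => Subtype.ext (by simp)) (fun _ _ _ => Subtype.ext (by simp))

/-- The Poisson bracket on the reduced space. -/
theorem IsStabilizer.exists_reducedBracket (hω : IsSymplecticGroupoid 𝒢 ω)
    (hS : IsCoisotropic (baseBracket 𝒢 ω) H.objects) (hH : H.IsStabilizer ω)
    (hα : IsHamiltonian ω α P) (hP : IsPoissonBracket P) :
    ∃ Q : H.invariants α →ₗ[k] H.invariants α →ₗ[k] H.invariants α, IsPoissonBracket Q ∧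
      ∀ f g : H.liftedInvariants α, Q (H.restrictInvariants α f) (H.restrictInvariants α g) =
        H.restrictInvariants α
          (hH.liftedBracket hω hS hα hP.isSkewBiderivation f g) := by
  have hP' := hP.isSkewBiderivation
  have h : IsPoissonBracket (hH.liftedBracket hω hS hα hP') :=
    { self_eq_zero := fun f => Subtype.ext (hP.self_eq_zero f)
      jacobi := fun f g l => Subtype.ext (hP.jacobi f g l)
      leibniz := fun f g l => Subtype.ext (hP.leibniz f g l) }
  obtain ⟨Q, hQ⟩ := h.isSkewBiderivation.exists_descent (H.restrictInvariants α)
    restrictInvariants_surjective fun x y hx => Subtype.ext <| by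
      have hx' : (x : M) ∈ H.fibreIdeal α := (H.j_eq_zero_iff α).1 (congrArg Subtype.val hx)
      refine (H.j_eq_zero_iff α).2 ?_
      change P x y ∈ _
      rw [hP'.skew]
      exact neg_mem (hH.bracket_fibreIdeal_mem hω hS hα hP' hx' y.2)
  exact ⟨Q, h.of_surjective _ restrictInvariants_surjective hQ, hQ⟩

end ClosedSubgroupoid

/-! ### The residual action is Hamiltonian -/

section Hamiltonian

variable {k : Type*} [CommRing k] {R : Type u₁} {A : Type u₂} [CommRing R] [CommRing A]
  [Algebra k R] [Algebra k A] {𝒢 : LieGroupoid k R A} {ω : SymplecticForm k A}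

/-- Restriction to the graph of an action. -/
def evalGraph {N : Type*} [CommRing N] [Algebra k N] (ρ : Action 𝒢 N) :
    (A ⊗[k] N) ⊗[k] N →ₐ[k] FibreProd 𝒢.src ρ.moment :=
  Algebra.TensorProduct.productMap (FibreProd.ofTensor 𝒢.src ρ.moment) ρ.coact

theorem mem_graphIdeal_coact {N : Type*} [CommRing N] [Algebra k N] {ρ : Action 𝒢 N}
    {x : (A ⊗[k] N) ⊗[k] N} : x ∈ FibreProd.graphIdeal ρ.coact ↔ evalGraph ρ x = 0 :=
  Iff.rfl

theorem evalGraph_surjective {N : Type*} [CommRing N] [Algebra k N] (ρ : Action 𝒢 N) :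
    Function.Surjective (evalGraph ρ) := fun x => by
  obtain ⟨z, rfl⟩ := FibreProd.ofTensor_surjective 𝒢.src ρ.moment x
  exact ⟨z ⊗ₜ 1, by simp [evalGraph]⟩

variable {M : Type u₃} {F : Type u₄} {N : Type u₅} {M' : Type*}
  [CommRing M] [CommRing F] [CommRing N] [CommRing M'] [Algebra k M] [Algebra k F] [Algebra k N]
  [Algebra k M'] {α : Action 𝒢 M} {ρ : Action 𝒢 N} {τ : R →ₐ[k] F} {j : M →ₐ[k] F} {i : N →ₐ[k] F}
  {ι : M' →ₐ[k] M} {π : M' →ₐ[k] N} {P : M →ₗ[k] M →ₗ[k] M} {P' : M' →ₗ[k] M' →ₗ[k] M'}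
  {Q : N →ₗ[k] N →ₗ[k] N}

/-- Functions on `𝒢 × Spec N × Spec N` and on `𝒢 × Spec M × Spec M` with a common lift have the same
restriction to the graph of the action on `Spec F`. -/
theorem mapRight_evalGraph (hj : j.comp α.moment = τ) (hi : i.comp ρ.moment = τ)
    {φ : F →ₐ[k] FibreProd 𝒢.src τ}
    (hφj : φ.comp j = (FibreProd.mapRight 𝒢.src j hj).comp α.coact)
    (hφi : φ.comp i = (FibreProd.mapRight 𝒢.src i hi).comp ρ.coact)
    (hc : i.comp π = j.comp ι) (x : (A ⊗[k] M') ⊗[k] M') :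
    FibreProd.mapRight 𝒢.src i hi (evalGraph ρ (Algebra.TensorProduct.map
      (Algebra.TensorProduct.map (AlgHom.id k A) π) π x)) =
    FibreProd.mapRight 𝒢.src j hj (evalGraph α (Algebra.TensorProduct.map
      (Algebra.TensorProduct.map (AlgHom.id k A) ι) ι x)) := by
  have hc' : ∀ f, i (π f) = j (ι f) := DFunLike.congr_fun hc
  have e : ∀ f, FibreProd.mapRight 𝒢.src i hi (ρ.coact (π f)) =
      FibreProd.mapRight 𝒢.src j hj (α.coact (ι f)) := fun f => by
    have h₁ := DFunLike.congr_fun hφi (π f)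
    have h₂ := DFunLike.congr_fun hφj (ι f)
    simp only [AlgHom.comp_apply] at h₁ h₂
    rw [← h₁, ← h₂, hc']
  induction x using TensorProduct.induction_on with
  | zero => simp
  | add x y hx hy => simp only [map_add, hx, hy]
  | tmul x f' =>
    induction x using TensorProduct.induction_on with
    | zero => simp
    | add x y hx hy => rw [TensorProduct.add_tmul]; simp only [map_add, hx, hy]
    | tmul a f => simp [evalGraph, e, hc']

/-- Let `Spec F` be an invariant closed subscheme of the Hamiltonian `𝒢`-scheme `Spec M`, and `N` an
algebra of functions on `Spec F` stable under the coaction. Suppose that the functions in `N`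
are the restrictions of those in a Poisson algebra `M'` of functions on `Spec M` in which the
ideal of `Spec F` is a Poisson ideal. Then `Spec N` is Hamiltonian for the quotient bracket. -/
theorem IsHamiltonian.reduction (hα : IsHamiltonian ω α P) (hP : IsSkewBiderivation P)
    (hj : j.comp α.moment = τ) (hi : i.comp ρ.moment = τ)
    {φ : F →ₐ[k] FibreProd 𝒢.src τ}
    (hφj : φ.comp j = (FibreProd.mapRight 𝒢.src j hj).comp α.coact)
    (hφi : φ.comp i = (FibreProd.mapRight 𝒢.src i hi).comp ρ.coact)
    (hjs : Function.Surjective j) (his : Function.Injective i) (hπ : Function.Surjective π)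
    (hc : i.comp π = j.comp ι) (hι : ∀ m, j m = 0 → m ∈ ι.range)
    (hιP : ∀ x y, ι (P' x y) = P (ι x) (ι y)) (hπP : ∀ x y, π (P' x y) = Q (π x) (π y))
    (hker : ∀ f m, j m = 0 → j (P (ι f) m) = 0) :
    IsHamiltonian ω ρ Q := by
  have hb := ω.isSkewBiderivation_bracket
  have hp := (hb.prodBracket hP).prodBracket hP.neg
  let bM := prodBracket (prodBracket ω.bracket P) (-P)
  let bM' := prodBracket (prodBracket ω.bracket P') (-P')
  let bQ := prodBracket (prodBracket ω.bracket Q) (-Q)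
  let ιT := Algebra.TensorProduct.map (Algebra.TensorProduct.map (AlgHom.id k A) ι) ι
  let πT := Algebra.TensorProduct.map (Algebra.TensorProduct.map (AlgHom.id k A) π) π
  have hπT : Function.Surjective πT :=
    TensorProduct.map_surjective (TensorProduct.map_surjective Function.surjective_id hπ) hπ
  have hιT : ∀ x y, ιT (bM' x y) = bM (ιT x) (ιT y) :=
    prodBracket_map _ _ (prodBracket_map _ _ (fun _ _ => rfl) hιP) fun x y => by simp [hιP]
  have hπTb : ∀ x y, πT (bM' x y) = bQ (πT x) (πT y) :=
    prodBracket_map _ _ (prodBracket_map _ _ (fun _ _ => rfl) hπP) fun x y => by simp [hπP]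
  let κ := FibreProd.mapRight 𝒢.src j hj
  have hcomp : ∀ x, FibreProd.mapRight 𝒢.src i hi (evalGraph ρ (πT x)) = κ (evalGraph α (ιT x)) :=
    mapRight_evalGraph hj hi hφj hφi hc
  -- the ideal of the preimage of `Spec F` under the second projection
  let n : M →ₐ[k] (A ⊗[k] M) ⊗[k] M :=
    (Algebra.TensorProduct.includeLeft : A ⊗[k] M →ₐ[k] _).comp
      (Algebra.TensorProduct.includeRight : M →ₐ[k] A ⊗[k] M)
  let N := (RingHom.ker j).map n
  have hn : ∀ m, evalGraph α (n m) = FibreProd.inr _ _ m := fun m => by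
    simp [n, evalGraph]
  have hκN : ∀ y ∈ N, κ (evalGraph α y) = 0 := fun y hy => by
    suffices hle : N ≤ RingHom.ker (κ.comp (evalGraph α)) from hle hy
    refine Ideal.map_le_iff_le_comap.2 fun m hm => ?_
    rw [Ideal.mem_comap, RingHom.mem_ker, AlgHom.comp_apply, hn, FibreProd.mapRight_inr_apply,
      RingHom.mem_ker.1 hm, map_zero]
  have hN : ∀ x, ∀ y ∈ N, bM (ιT x) y ∈ N := fun x y hy => by
    refine hp.mem_span ?_ hy
    rintro _ ⟨m, hm, rfl⟩
    change bM (ιT x) (n m) ∈ N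
    induction x using TensorProduct.induction_on with
    | zero => simp
    | add x y hx hy => rw [map_add, map_add, LinearMap.add_apply]; exact add_mem hx hy
    | tmul x f' =>
      induction x using TensorProduct.induction_on with
      | zero => simp
      | add x y hx hy =>
        rw [TensorProduct.add_tmul, map_add, map_add, LinearMap.add_apply]; exact add_mem hx hy
      | tmul a f =>
        have : bM (ιT ((a ⊗ₜ f) ⊗ₜ f')) (n m) = ((a ⊗ₜ 1) ⊗ₜ ι f') * n (P (ι f) m) := by
          simp [bM, ιT, n, hb.one_right, hP.one_right]
        rw [this]
        exact Ideal.mul_mem_left _ _ (Ideal.mem_map_of_mem _ (hker f m hm))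
  have hNN : IsCoisotropic bM N := by
    refine hp.isCoisotropic_span ?_
    rintro _ ⟨m, hm, rfl⟩ _ ⟨m', hm', rfl⟩
    obtain ⟨f, rfl⟩ := hι m hm
    have : ιT ((1 ⊗ₜ f) ⊗ₜ 1) = n (ι f) := by simp [ιT, n]
    change bM (n (ι f)) (n m') ∈ N
    rw [← this]
    exact hN _ _ (Ideal.mem_map_of_mem _ hm')
  -- equations of the graph of `ρ` lift to equations of the graph of `α`, up to `N`
  have hlift : ∀ x, evalGraph ρ (πT x) = 0 →
      ∃ y ∈ N, ιT x - y ∈ FibreProd.graphIdeal α.coact := fun x hx => by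
    have h₁ : evalGraph α (ιT x) ∈ RingHom.ker κ := by
      rw [RingHom.mem_ker, ← hcomp, hx, map_zero]
    have h₂ := FibreProd.ker_mapRight_le 𝒢.src j hj hjs h₁
    have h₄ : (RingHom.ker j).map (FibreProd.inr 𝒢.src α.moment) ≤ N.map (evalGraph α) :=
      Ideal.map_le_iff_le_comap.2 fun m hm => by
        rw [Ideal.mem_comap, ← hn]
        exact Ideal.mem_map_of_mem _ (Ideal.mem_map_of_mem _ hm)
    obtain ⟨y, hy, hy'⟩ := (Ideal.mem_map_iff_of_surjective _ (evalGraph_surjective α)).1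
      (h₄ h₂)
    exact ⟨y, hy, by rw [mem_graphIdeal_coact, map_sub, hy', sub_self]⟩
  intro u hu v hv
  rw [mem_graphIdeal_coact] at hu hv ⊢
  obtain ⟨x, rfl⟩ := hπT u
  obtain ⟨y, rfl⟩ := hπT v
  obtain ⟨x₁, hx₁, hx⟩ := hlift x hu
  obtain ⟨y₁, hy₁, hy⟩ := hlift y hv
  have h₁ : κ (evalGraph α (bM (ιT x - x₁) (ιT y - y₁))) = 0 := by
    rw [mem_graphIdeal_coact.1 (hα _ hx _ hy), map_zero]
  have h₂ : bM (ιT x) (ιT y) = bM (ιT x - x₁) (ιT y - y₁) +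
      (bM (ιT x) y₁ - bM (ιT y) x₁ - bM x₁ y₁) := by
    rw [show bM (ιT y) x₁ = -bM x₁ (ιT y) from hp.skew _ _]
    simp only [map_sub, LinearMap.sub_apply]
    ring
  apply FibreProd.mapRight_injective 𝒢.src 𝒢.smooth_src.flat i hi his
  change FibreProd.mapRight 𝒢.src i hi (evalGraph ρ (bQ (πT x) (πT y))) = _
  rw [map_zero, ← hπTb, hcomp, hιT, h₂, map_add, map_add, h₁, zero_add]
  exact hκN _ (sub_mem (sub_mem (hN x _ hy₁) (hN y _ hx₁)) (hNN _ hx₁ _ hy₁))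

end Hamiltonian

end AffineGroupoid

end

theorem theorem2 {𝕜 : Type*} [RCLike 𝕜]
    {X G Y I M : Type*} [CommRing X] [CommRing G] [CommRing Y] [CommRing I] [CommRing M]
    [Algebra 𝕜 X] [Algebra 𝕜 G] [Algebra 𝕜 Y] [Algebra 𝕜 I] [Algebra 𝕜 M]
    (𝒢 : AffineGroupoid.LieGroupoid 𝕜 X G) (ℐ : AffineGroupoid.LieGroupoid 𝕜 Y I)
    (H : AffineGroupoid.ClosedSubgroupoid ℐ)
    (α : AffineGroupoid.Action 𝒢 M) (β : AffineGroupoid.Action ℐ M)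
    (hcomm : AffineGroupoid.Commuting α β) :
    -- (i) the coaction `α.coact` descends to `k[ν⁻¹(S)]`, giving `φ`
    ∃ φ : H.Fibre β →ₐ[𝕜] AffineGroupoid.FibreProd 𝒢.src (AffineGroupoid.momentFibre α β H),
      φ.comp (H.j β) = (AffineGroupoid.FibreProd.mapRight 𝒢.src (H.j β) rfl).comp α.coact ∧
      -- (ii) `φ` maps the invariants to the subalgebra `k[𝒢] ⊗ k[ν⁻¹(S)]^ℋ`
      Function.Injective (AffineGroupoid.residualIncl hcomm H) ∧
      (∀ b ∈ H.invariants β, φ b ∈ (AffineGroupoid.residualIncl hcomm H).range) ∧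
      -- (iii) the restriction of `φ` is an affine `𝒢`-scheme structure over the residual moment map
      ∃ (ρ : AffineGroupoid.Action 𝒢 (H.invariants β))
        (hρ : ρ.moment = AffineGroupoid.momentResidual hcomm H),
        (AffineGroupoid.FibreProd.mapRight 𝒢.src (H.invariants β).val (by rw [hρ]; rfl) :
            AffineGroupoid.FibreProd 𝒢.src ρ.moment →ₐ[𝕜]
              AffineGroupoid.FibreProd 𝒢.src (AffineGroupoid.momentFibre α β H)).comp ρ.coact =
          φ.comp (H.invariants β).val ∧
        -- (iv) it is Hamiltonian for the induced Poisson bracket when the given actions are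
        ∀ (ω : AffineGroupoid.SymplecticForm 𝕜 G) (η : AffineGroupoid.SymplecticForm 𝕜 I)
          (P : M →ₗ[𝕜] M →ₗ[𝕜] M),
          AffineGroupoid.IsSymplecticGroupoid 𝒢 ω → AffineGroupoid.IsSymplecticGroupoid ℐ η →
          AffineGroupoid.IsPoissonBracket P →
          AffineGroupoid.IsHamiltonian ω α P → AffineGroupoid.IsHamiltonian η β P →
          AffineGroupoid.IsCoisotropic (AffineGroupoid.baseBracket ℐ η) H.objects →
          H.IsStabilizer η →
          ∃ Q : H.invariants β →ₗ[𝕜] H.invariants β →ₗ[𝕜] H.invariants β,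
            AffineGroupoid.IsPoissonBracket Q ∧
            AffineGroupoid.IsInducedBracket H β P Q ∧
            (∀ Q' : H.invariants β →ₗ[𝕜] H.invariants β →ₗ[𝕜] H.invariants β,
              AffineGroupoid.IsPoissonBracket Q' → AffineGroupoid.IsInducedBracket H β P Q' →
                Q' = Q) ∧
            AffineGroupoid.IsHamiltonian ω ρ Q := by
  refine ⟨AffineGroupoid.coactFibre hcomm H, AffineGroupoid.coactFibre_comp_j hcomm H,
    AffineGroupoid.residualIncl_injective hcomm H,
    fun b hb => AffineGroupoid.coactFibre_mem_range hcomm H hb,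
    AffineGroupoid.residualAction hcomm H, rfl,
    AffineGroupoid.residualIncl_comp_coactResidual hcomm H, ?_⟩
  intro ω η P _ hη hP hα hβ hS hH
  have hP' := hP.isSkewBiderivation
  obtain ⟨Q, hQ, hQP⟩ := hH.exists_reducedBracket hη hS hβ hP
  have hind : AffineGroupoid.IsInducedBracket H β P Q := fun f₁ f₂ h₁ h₂ =>
    congrArg Subtype.val (hQP ⟨f₁, h₁⟩ ⟨f₂, h₂⟩)
  refine ⟨Q, hQ, hind, fun Q' _ hQ' => ?_, ?_⟩
  · ext ⟨b₁, h₁⟩ ⟨b₂, h₂⟩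
    obtain ⟨f₁, rfl⟩ := H.j_surjective β b₁
    obtain ⟨f₂, rfl⟩ := H.j_surjective β b₂
    rw [hQ' f₁ f₂ h₁ h₂, hind f₁ f₂ h₁ h₂]
  · refine hα.reduction (ι := (H.liftedInvariants β).val) (π := H.restrictInvariants β)
      (i := (H.invariants β).val) (P' := hH.liftedBracket hη hS hβ hP') hP'
      (AffineGroupoid.j_comp_moment α β H) (AffineGroupoid.val_comp_momentResidual hcomm H)
      (AffineGroupoid.coactFibre_comp_j hcomm H)
      (AffineGroupoid.residualIncl_comp_coactResidual hcomm H).symm (H.j_surjective β)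
      Subtype.val_injective AffineGroupoid.ClosedSubgroupoid.restrictInvariants_surjective rfl
      (fun m hm => ?_) (fun _ _ => rfl) (fun x y => (hQP x y).symm) (fun f m hm => ?_)
    · refine ⟨⟨m, ?_⟩, rfl⟩
      change H.j β m ∈ H.invariants β
      rw [hm]
      exact zero_mem _
    · rw [H.j_eq_zero_iff] at hm ⊢
      exact hH.bracket_fibreIdeal_mem hη hS hβ hP' hm f.2
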